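/- **Setting.** Fix a capacity $k\ge 1$ and a stream of items $1,2,\dots$ with weights $w_i>0$. A reservoir $R_j$ of at most $k$ of the first $j$ items is maintained together with adjusted weights $\tilde w_i$ and a threshold $\tau_j$. For $j\le k$ we have $R_j=\{1,\dots,j\}$, $\tilde w_i=w_i$ and $\tau_j=0$. For $j>k$, item $j$ is added with $\tilde w_j=w_j$, giving $R^{\mathrm{pre}}_j=R_{j-1}\cup\{j\}$ with $k+1$ items; $\tau_j=\tau$ is the number $\tau>0$ with $\sum_{i\in R^{\mathrm{pre}}_j}\min\{1,\tilde w_i/\tau\}=k$; for $r_j\in(0,1)$ uniformly random, and $\tilde w_{(1)}\le\dots\le\tilde w_{(k+1)}$ the adjusted weights in $R^{\mathrm{pre}}_j$ in sorted order (ties broken arbitrarily), the item dropped is the one with the smallest index $d$ with $\tilde w_{(d)}\le\tau$ and $\sum_{x\le d}(1-\tilde w_{(x)}/\tau)\ge r_j$; the remaining $k$ items form $R_j$, with new adjusted weights $\max\{\tilde w_i,\tau\}$. **Implementation.** $R_j$ is stored as two height-balanced binary trees: $L$, holding the large items ($w_i>\tau_j$, $\tilde w_i=w_i$) sorted by weight,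 and $T$, holding the small items ($w_i\le\tau_j$, $\tilde w_i=\tau_j$) in arbitrary order. Each node stores the height, the number of items and the total weight of its subtree. Joining, splitting at a position, concatenation, insertion and deletion are done by the usual rebalancing with rotations. While fewer than $k$ items are stored, a new item is inserted into $L$. Otherwise item $j$ is processed as follows. If $w_j>\tau_{j-1}$, insert $j$ into $L$. Descend from the root of $L$, accumulating counts and sums (starting from those of $T$, and of $j$ if $w_j\le\tau_{j-1}$), to find the largest $t$ with $\sum_{x\le t}\tilde w_{(x)}\ge(t-1)\tilde w_{(t)}$, and set $\tau_j=\big(\sum_{x\le t}\tilde w_{(x)}\big)/(t-1)$. Find the smallest $d\le t$ with $d\,\tau_j-\sum_{x\le d}\tilde w_{(x)}\ge r_j\tau_j$ by first considering $j$ if $w_j\le\tau_{j-1}$ and then descending in $T$ or in $L$ in the same way. If $w_j\le\tau_{j-1}$, insert $j$ into $T$. Delete the $d$-th item from its tree. If the $t$-th item was in $L$, split off the prefix of $L$ consisting of the items of rank at most $t$ and concatenate it to $T$. Time is the number of elementary operations, each of unit cost: arithmetic and comparison of real numbers and counters, and reading, inspecting or allocating a tree node. **Theorem.** The implementation is correct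 and processes each item in $O(\log k)$ worst-case time. That is, there is an absolute constant $C$ such that for every $k\ge1$, all positive weights $w_1,w_2,\dots$, all $r_1,r_2,\dots\in(0,1)$ and every $j\ge1$: 1. item $j$ is processed in at most $C\log(k+1)$ time; 2. before and after processing item $j$, the two trees are height-balanced, store correct heights, counts and sums, and represent the current reservoir as described, with $\min\{n,k\}$ distinct items after $n$ items; and whenever $n>k$ items have been seen, the stored threshold satisfies $\tau_n>0$ and $\sum_{i\le n}\min\{1,w_i/\tau_n\}=k$; 3. if $j\le k$, item $j$ is added to the reservoir with adjusted weight $w_j$, and the other items and adjusted weights are unchanged; if $j>k$, then $\tau_j$, $R_j$ and its adjusted weights arise from $R_{j-1}$, item $j$ and $r_j$ by the sampling rule of the setting; moreover, for a uniformly random $r_j\in(0,1)$ (with the earlier $r_i$ fixed), each $i\in R^{\mathrm{pre}}_j$ is dropped with probability $1-\min\{1,\tilde w_i/\tau_j\}$. -/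

import Mathlib

open MeasureTheory

noncomputable section

namespace VarOpt

/-! ### Step counting on a real RAM

A computation returns a value together with the number of elementary operations performed.  The
unit-cost elementary operations are exactly the ones listed below: arithmetic and comparisons of
real numbers and of integer counters, reading a field stored at the root of a tree, inspecting or
allocating a tree node.  All programs below are built from these with `pure` (cost `0`) and the
monadic `bind` (costs add up). -/

/-- A value together with the number of elementary steps used to compute it. -/
structure Timed (α : Type) where
  val : α
  time : ℕ

instance : Monad Timed where
  pure a := ⟨a, 0⟩
  bind m f := ⟨(f m.val).val, m.time + (f m.val).time⟩

/-- One elementary step with result `a`. -/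
def step {α : Type} (a : α) : Timed α := ⟨a, 1⟩

def radd (a b : ℝ) : Timed ℝ := step (a + b)
def rsub (a b : ℝ) : Timed ℝ := step (a - b)
def rmul (a b : ℝ) : Timed ℝ := step (a * b)
def rdiv (a b : ℝ) : Timed ℝ := step (a / b)
def rle (a b : ℝ) : Timed Bool := step (decide (a ≤ b))
def rlt (a b : ℝ) : Timed Bool := step (decide (a < b))
def nadd (a b : ℕ) : Timed ℕ := step (a + b)
def nsub (a b : ℕ) : Timed ℕ := step (a - b)
def nmax (a b : ℕ) : Timed ℕ := step (max a b)
def nle (a b : ℕ) : Timed Bool := step (decide (a ≤ b))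
def nlt (a b : ℕ) : Timed Bool := step (decide (a < b))
def toReal (n : ℕ) : Timed ℝ := step (n : ℝ)

/-! ### Augmented balanced binary search trees -/

/-- An item of the stream: its index and its (original) weight. -/
structure Item where
  id : ℕ
  w : ℝ

/-- Binary trees of items.  A node stores, besides its two children and its item, the height of its
subtree, the number of items in its subtree, and their total weight. -/
inductive Tree where
  | nil : Tree
  | node (l : Tree) (x : Item) (r : Tree) (height size : ℕ) (total : ℝ) : Tree

namespace Tree

/-- Read the stored height. -/
def height : Tree → Timed ℕ
  | nil => step 0
  | node _ _ _ h _ _ => step h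

/-- Read the stored number of items. -/
def size : Tree → Timed ℕ
  | nil => step 0
  | node _ _ _ _ n _ => step n

/-- Read the stored total weight. -/
def total : Tree → Timed ℝ
  | nil => step 0
  | node _ _ _ _ _ s => step s

/-- Allocate a node with the given children and item, computing the stored fields. -/
def mk (l : Tree) (x : Item) (r : Tree) : Timed Tree := do
  let hl ← l.height
  let hr ← r.height
  let hm ← nmax hl hr
  let h ← nadd hm 1
  let nl ← l.size
  let nr ← r.size
  let nm ← nadd nl nr
  let n ← nadd nm 1
  let sl ← l.total
  let sr ← r.total
  let sm ← radd sl sr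
  let s ← radd sm x.w
  step (node l x r h n s)

/-- Node with children `l`, `t`, repaired by a single or double left rotation if `t` is too high. -/
def balR (l : Tree) (y : Item) (t : Tree) : Timed Tree := do
  let hl ← l.height
  let ht ← t.height
  let hl1 ← nadd hl 1
  let ok ← nle ht hl1
  if ok then mk l y t
  else
    match t with
    | nil => mk l y nil
    | node a z b _ _ _ => do
      let ha ← a.height
      let hb ← b.height
      let single ← nle ha hb
      if single then do
        let u ← mk l y a
        mk u z b
      else
        match a with
        | nil => mk l y t
        | node a₁ v a₂ _ _ _ => do
          let u₁ ← mk l y a₁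
          let u₂ ← mk a₂ z b
          mk u₁ v u₂

/-- Node with children `t`, `r`, repaired by a single or double right rotation if `t` is too
high. -/
def balL (t : Tree) (y : Item) (r : Tree) : Timed Tree := do
  let hr ← r.height
  let ht ← t.height
  let hr1 ← nadd hr 1
  let ok ← nle ht hr1
  if ok then mk t y r
  else
    match t with
    | nil => mk nil y r
    | node a z b _ _ _ => do
      let ha ← a.height
      let hb ← b.height
      let single ← nle hb ha
      if single then do
        let u ← mk b y r
        mk a z u
      else
        match b with
        | nil => mk t y r
        | node b₁ v b₂ _ _ _ => do
          let u₁ ← mk a z b₁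
          let u₂ ← mk b₂ y r
          mk u₁ v u₂

/-- Join `l`, `x`, `r` where `l` may be much higher than `r`: descend along the right spine
of `l`. -/
def joinR (l : Tree) (x : Item) (r : Tree) : Timed Tree :=
  match l with
  | nil => mk nil x r
  | node ll y lr h n s => do
    let hl ← (node ll y lr h n s).height
    let hr ← r.height
    let hr1 ← nadd hr 1
    let ok ← nle hl hr1
    if ok then mk (node ll y lr h n s) x r
    else do
      let t ← joinR lr x r
      balR ll y t

/-- Join `l`, `x`, `r` where `r` may be much higher than `l`: descend along the left spine
of `r`. -/
def joinL (l : Tree) (x : Item) (r : Tree) : Timed Tree :=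
  match r with
  | nil => mk l x nil
  | node rl y rr h n s => do
    let hr ← (node rl y rr h n s).height
    let hl ← l.height
    let hl1 ← nadd hl 1
    let ok ← nle hr hl1
    if ok then mk l x (node rl y rr h n s)
    else do
      let t ← joinL l x rl
      balL t y rr

/-- The list of `l`, then `x`, then the list of `r`, as one balanced tree. -/
def join (l : Tree) (x : Item) (r : Tree) : Timed Tree := do
  let hl ← l.height
  let hr ← r.height
  let c ← nle hr hl
  if c then joinR l x r else joinL l x r

/-- Split off the first `p` items. -/
def split (t : Tree) (p : ℕ) : Timed (Tree × Tree) :=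
  match t with
  | nil => step (nil, nil)
  | node l y r _ _ _ => do
    let nl ← l.size
    let c ← nle p nl
    if c then do
      let ab ← split l p
      let b ← join ab.2 y r
      pure (ab.1, b)
    else do
      let nl1 ← nadd nl 1
      let q ← nsub p nl1
      let ab ← split r q
      let a ← join l y ab.1
      pure (a, ab.2)

/-- Remove the first item of the tree with root item `x` and children `l`, `r`. -/
def popFirst (l : Tree) (x : Item) (r : Tree) : Timed (Item × Tree) :=
  match l with
  | nil => step (x, r)
  | node ll y lr _ _ _ => do
    let m ← popFirst ll y lr
    let t ← join m.2 x r
    pure (m.1, t)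

/-- Concatenate two trees. -/
def concat (a b : Tree) : Timed Tree :=
  match b with
  | nil => step a
  | node l x r _ _ _ => do
    let m ← popFirst l x r
    join a m.1 m.2

/-- Insert `x` after the first `p` items. -/
def insertAt (t : Tree) (p : ℕ) (x : Item) : Timed Tree := do
  let ab ← split t p
  join ab.1 x ab.2

/-- Delete the item that is preceded by exactly `p` items. -/
def deleteAt (t : Tree) (p : ℕ) : Timed Tree := do
  let ab ← split t p
  match ab.2 with
  | nil => step ab.1
  | node l x r _ _ _ => do
    let m ← popFirst l x r
    concat ab.1 m.2

/-- Binary search down from the root.  The counters `c` and `s` accumulate the number and the total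
weight of the items to the left of the current subtree (on top of given initial values).  At a node,
`test` is called with the count and the total weight up to and including the item of this node, and
with the weight of this item; the search goes right if the answer is `true`, left otherwise.
Returned are the count and the total weight of the items found to pass. -/
def search (test : ℕ → ℝ → ℝ → Timed Bool) (t : Tree) (c : ℕ) (s : ℝ) : Timed (ℕ × ℝ) :=
  match t with
  | nil => step (c, s)
  | node l x r _ _ _ => do
    let nl ← l.size
    let sl ← l.total
    let c' ← nadd c nl
    let c₁ ← nadd c' 1
    let s' ← radd s sl
    let s₁ ← radd s' x.w
    let right ← test c₁ s₁ x.w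
    if right then search test r c₁ s₁ else search test l c s

/-- The items from left to right. -/
def toList : Tree → List Item
  | nil => []
  | node l x r _ _ _ => l.toList ++ x :: r.toList

/-- The actual height. -/
def depth : Tree → ℕ
  | nil => 0
  | node l _ r _ _ _ => max l.depth r.depth + 1

/-- Height-balanced: at each node the heights of the two children differ by at most one. -/
def Balanced : Tree → Prop
  | nil => True
  | node l _ r _ _ _ =>
    l.depth ≤ r.depth + 1 ∧ r.depth ≤ l.depth + 1 ∧ l.Balanced ∧ r.Balanced

/-- Every node stores the correct height, number of items and total weight of its subtree. -/
def Augmented : Tree → Prop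
  | nil => True
  | node l x r h n s =>
    h = (node l x r h n s).depth ∧ n = (node l x r h n s).toList.length ∧
      s = ((node l x r h n s).toList.map Item.w).sum ∧ l.Augmented ∧ r.Augmented

end Tree

/-! ### The reservoir and the processing of an item -/

/-- The reservoir: the tree of large items, the tree of small items, and the current threshold. -/
structure State where
  large : Tree
  small : Tree
  thr : ℝ

/-- The empty reservoir, with threshold `0`. -/
def State.init : State := ⟨Tree.nil, Tree.nil, 0⟩

/-- Insert an item into a tree sorted by weight. -/
def insertSorted (t : Tree) (x : Item) : Timed Tree := do
  let p ← t.search (fun _ _ w => rle w x.w) 0 0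
  t.insertAt p.1 x

/-- The reservoir together with the new item: the tree of large items (including a new large item),
whether the new item is small, and the number and total adjusted weight of all small items
(including a new small item). -/
structure Pre where
  large : Tree
  isSmall : Bool
  count : ℕ
  sum : ℝ

/-- Classify the new item, and insert it if it is large. -/
def prepare (st : State) (x : Item) : Timed Pre := do
  let isSmall ← rle x.w st.thr
  let m ← st.small.size
  let mr ← toReal m
  let s ← rmul mr st.thr
  if isSmall then do
    let b ← nadd m 1
    let s' ← radd s x.w
    pure ⟨st.large, true, b, s'⟩
  else do
    let l ← insertSorted st.large x
    pure ⟨l, false, m, s⟩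

/-- Find the largest `t` such that the `t`-th smallest adjusted weight `w` is at most the new
threshold, that is `(t - 1) * w ≤` the sum of the `t` smallest adjusted weights.  Returns `t` and
this sum. -/
def findCut (pre : Pre) : Timed (ℕ × ℝ) :=
  pre.large.search
    (fun c s w => do
      let c' ← nsub c 1
      let cr ← toReal c'
      let a ← rmul cr w
      rle a s)
    pre.count pre.sum

/-- `c * τ - s`. -/
def excess (τ : ℝ) (c : ℕ) (s : ℝ) : Timed ℝ := do
  let cr ← toReal c
  let a ← rmul cr τ
  rsub a s

/-- Search for the item to drop among the old small items and the large items.  Here `c₀` and `a₀`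
are the number and total weight of the items in front of the old small items (a new small item, if
any), `τ` is the new threshold and `ρ = r * τ`.  Returned is the number of items in front of the
item to drop. -/
def findDropOld (st : State) (pre : Pre) (τ ρ : ℝ) (c₀ : ℕ) (a₀ : ℝ) : Timed ℕ := do
  let e ← excess τ pre.count pre.sum
  let inSmall ← rle ρ e
  if inSmall then do
    let res ← st.small.search
      (fun c _ _ => do
        let m ← nsub c c₀
        let mr ← toReal m
        let a ← rmul mr st.thr
        let s ← radd a₀ a
        let v ← excess τ c s
        rlt v ρ)
      c₀ 0
    pure res.1
  else do
    let res ← pre.large.search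
      (fun c s w => do
        let below ← rle w τ
        if below then do
          let v ← excess τ c s
          rlt v ρ
        else pure false)
      pre.count pre.sum
    pure res.1

/-- Find the item to drop for the random number `r`, considering first the new item if it is small.
Returned is the number of items in front of the item to drop, in the order: new item (if small), old
small items, large items. -/
def findDrop (st : State) (x : Item) (pre : Pre) (τ r : ℝ) : Timed ℕ := do
  let ρ ← rmul r τ
  if pre.isSmall then do
    let q ← rsub τ x.w
    let first ← rle ρ q
    if first then step 0 else findDropOld st pre τ ρ 1 x.w
  else findDropOld st pre τ ρ 0 0

/-- Insert a small new item into the tree of small items. -/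
def insertSmall (st : State) (x : Item) (pre : Pre) : Timed Tree :=
  if pre.isSmall then st.small.insertAt 0 x else pure st.small

/-- Delete the item with `p` items in front of it from the tree containing it.  Returns the tree of
small items, the tree of large items, and how many of the latter became small, when `t` is the total
number of items before deletion that are now small. -/
def dropItem (sm : Tree) (pre : Pre) (t p : ℕ) : Timed (Tree × Tree × ℕ) := do
  let c ← nlt p pre.count
  let m ← nsub t pre.count
  if c then do
    let sm' ← sm.deleteAt p
    pure (sm', pre.large, m)
  else do
    let q ← nsub p pre.count
    let la ← pre.large.deleteAt q
    let m' ← nsub m 1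
    pure (sm, la, m')

/-- Process item `x` when the reservoir is full. -/
def processFull (st : State) (x : Item) (r : ℝ) : Timed State := do
  let pre ← prepare st x
  let cut ← findCut pre
  let t' ← nsub cut.1 1
  let tr ← toReal t'
  let τ ← rdiv cut.2 tr
  let p ← findDrop st x pre τ r
  let sm ← insertSmall st x pre
  let res ← dropItem sm pre cut.1 p
  let moved ← nlt pre.count cut.1
  if moved then do
    let ab ← res.2.1.split res.2.2
    let sm' ← res.1.concat ab.1
    pure ⟨ab.2, sm', τ⟩
  else pure ⟨res.2.1, res.1, τ⟩

/-- Process item `x` of the stream with a reservoir of capacity `k` and random number `r`. -/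
def process (k : ℕ) (st : State) (x : Item) (r : ℝ) : Timed State := do
  let a ← st.large.size
  let b ← st.small.size
  let n ← nadd a b
  let filling ← nlt n k
  if filling then do
    let l ← insertSorted st.large x
    pure ⟨l, st.small, st.thr⟩
  else processFull st x r

/-- The reservoir after the first `j` items (numbered `0, …, j - 1`) of the stream with weights `w`,
using the random number `r i` when processing item `i`. -/
def run (k : ℕ) (w r : ℕ → ℝ) : ℕ → State
  | 0 => State.init
  | j + 1 => (process k (run k w r j) ⟨j, w j⟩ (r j)).val

/-! ### What the implementation has to compute -/

/-- The sampled items with their adjusted weights: the threshold for items in the tree of small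
items, the original weight for items in the tree of large items. -/
def State.sample (st : State) : List (ℕ × ℝ) :=
  st.small.toList.map (fun x => (x.id, st.thr)) ++ st.large.toList.map (fun x => (x.id, x.w))

/-- `st` represents a reservoir of capacity `k` for the first `j` items of a stream with
weights `w`. -/
structure Represents (k : ℕ) (w : ℕ → ℝ) (j : ℕ) (st : State) : Prop where
  large_balanced : st.large.Balanced
  small_balanced : st.small.Balanced
  large_augmented : st.large.Augmented
  small_augmented : st.small.Augmented
  large_sorted : (st.large.toList.map Item.w).Pairwise (· ≤ ·)
  large_items : ∀ x ∈ st.large.toList, x.id < j ∧ x.w = w x.id ∧ st.thr < x.w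
  small_items : ∀ x ∈ st.small.toList, x.id < j ∧ x.w = w x.id ∧ x.w ≤ st.thr
  nodup : (st.sample.map Prod.fst).Nodup
  card : st.sample.length = min j k
  thr_init : j ≤ k → st.thr = 0
  thr_pos : k < j → 0 < st.thr
  thr_eq : k < j → ∑ i ∈ Finset.range j, min 1 (w i / st.thr) = k

/-- One round of threshold sampling of `k` out of the `k + 1` weighted items in `pre`, driven
by `r`: `τ` is the threshold, and for some arrangement of the items in nondecreasing order of
adjusted weight, the item to drop is the first one, among those of adjusted weight at most `τ`, up
to which the drop probabilities `1 - a / τ` add up to at least `r`.  The items left get adjusted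
weight at least `τ`. -/
def IsRound (k : ℕ) (pre : List (ℕ × ℝ)) (r τ : ℝ) (post : List (ℕ × ℝ)) : Prop :=
  0 < τ ∧ (pre.map fun p => min 1 (p.2 / τ)).sum = k ∧
  ∃ l : List (ℕ × ℝ), l.Perm pre ∧ l.Pairwise (fun p q => p.2 ≤ q.2) ∧
    ∃ (d : ℕ) (hd : d < l.length), (l[d]'hd).2 ≤ τ ∧
      r ≤ ((l.take (d + 1)).map fun p => 1 - p.2 / τ).sum ∧
      (∀ e < d, ((l.take (e + 1)).map fun p => 1 - p.2 / τ).sum < r) ∧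
      post.Perm ((l.eraseIdx d).map fun p => (p.1, max p.2 τ))

end VarOpt

end

noncomputable section

namespace VarOpt

/-! ### Values and running times of elementary programs -/

namespace Timed

variable {α β : Type}

@[simp] theorem val_bind (m : Timed α) (f : α → Timed β) : (m >>= f).val = (f m.val).val := rfl

@[simp] theorem time_bind (m : Timed α) (f : α → Timed β) :
    (m >>= f).time = m.time + (f m.val).time := rfl

@[simp] theorem val_pure (a : α) : (pure a : Timed α).val = a := rfl

@[simp] theorem time_pure (a : α) : (pure a : Timed α).time = 0 := rfl

@[simp] theorem val_step (a : α) : (step a).val = a := rfl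

@[simp] theorem time_step (a : α) : (step a).time = 1 := rfl

@[simp] theorem val_ite (p : Prop) [Decidable p] (a b : Timed α) :
    (if p then a else b).val = if p then a.val else b.val := by split_ifs <;> rfl

@[simp] theorem time_ite (p : Prop) [Decidable p] (a b : Timed α) :
    (if p then a else b).time = if p then a.time else b.time := by split_ifs <;> rfl

end Timed

section

variable (a b : ℝ) (m n : ℕ)

@[simp] theorem radd_val : (radd a b).val = a + b := rfl
@[simp] theorem rsub_val : (rsub a b).val = a - b := rfl
@[simp] theorem rmul_val : (rmul a b).val = a * b := rfl
@[simp] theorem rdiv_val : (rdiv a b).val = a / b := rfl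
@[simp] theorem rle_val : (rle a b).val = true ↔ a ≤ b := by simp [rle]
@[simp] theorem rlt_val : (rlt a b).val = true ↔ a < b := by simp [rlt]
@[simp] theorem nadd_val : (nadd m n).val = m + n := rfl
@[simp] theorem nsub_val : (nsub m n).val = m - n := rfl
@[simp] theorem nmax_val : (nmax m n).val = max m n := rfl
@[simp] theorem nle_val : (nle m n).val = true ↔ m ≤ n := by simp [nle]
@[simp] theorem nlt_val : (nlt m n).val = true ↔ m < n := by simp [nlt]
@[simp] theorem toReal_val : (toReal n).val = n := rfl
@[simp] theorem radd_time : (radd a b).time = 1 := rfl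
@[simp] theorem rsub_time : (rsub a b).time = 1 := rfl
@[simp] theorem rmul_time : (rmul a b).time = 1 := rfl
@[simp] theorem rdiv_time : (rdiv a b).time = 1 := rfl
@[simp] theorem rle_time : (rle a b).time = 1 := rfl
@[simp] theorem rlt_time : (rlt a b).time = 1 := rfl
@[simp] theorem nadd_time : (nadd m n).time = 1 := rfl
@[simp] theorem nsub_time : (nsub m n).time = 1 := rfl
@[simp] theorem nmax_time : (nmax m n).time = 1 := rfl
@[simp] theorem nle_time : (nle m n).time = 1 := rfl
@[simp] theorem nlt_time : (nlt m n).time = 1 := rfl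
@[simp] theorem toReal_time : (toReal n).time = 1 := rfl

end

/-- Total original weight of a list of items. -/
def weight (l : List Item) : ℝ := (l.map Item.w).sum

@[simp] theorem weight_nil : weight [] = 0 := rfl

@[simp] theorem weight_cons (x : Item) (l : List Item) : weight (x :: l) = x.w + weight l := by
  simp [weight]

@[simp] theorem weight_append (l m : List Item) : weight (l ++ m) = weight l + weight m := by
  simp [weight]

namespace Tree

/-- Height-balanced with correct stored fields. -/
structure Good (t : Tree) : Prop where
  balanced : t.Balanced
  augmented : t.Augmented

theorem good_nil : nil.Good := ⟨trivial, trivial⟩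

@[simp] theorem depth_nil : nil.depth = 0 := rfl

@[simp] theorem depth_node (l x r h n s) :
    (node l x r h n s).depth = max l.depth r.depth + 1 := rfl

@[simp] theorem toList_nil : nil.toList = [] := rfl

@[simp] theorem toList_node (l x r h n s) :
    (node l x r h n s).toList = l.toList ++ x :: r.toList := rfl

namespace Good

variable {l r t : Tree} {x : Item} {h n : ℕ} {s : ℝ}

theorem left (H : (node l x r h n s).Good) : l.Good :=
  ⟨H.balanced.2.2.1, H.augmented.2.2.2.1⟩

theorem right (H : (node l x r h n s).Good) : r.Good :=
  ⟨H.balanced.2.2.2, H.augmented.2.2.2.2⟩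

theorem left_le (H : (node l x r h n s).Good) : l.depth ≤ r.depth + 1 := H.balanced.1

theorem right_le (H : (node l x r h n s).Good) : r.depth ≤ l.depth + 1 := H.balanced.2.1

theorem height_val (H : t.Good) : t.height.val = t.depth := by
  cases t with
  | nil => rfl
  | node => exact H.augmented.1

theorem size_val (H : t.Good) : t.size.val = t.toList.length := by
  cases t with
  | nil => rfl
  | node => exact H.augmented.2.1

theorem total_val (H : t.Good) : t.total.val = weight t.toList := by
  cases t with
  | nil => rfl
  | node => exact H.augmented.2.2.1

end Good

@[simp] theorem height_time (t : Tree) : t.height.time = 1 := by cases t <;> rfl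

@[simp] theorem size_time (t : Tree) : t.size.time = 1 := by cases t <;> rfl

@[simp] theorem total_time (t : Tree) : t.total.time = 1 := by cases t <;> rfl

@[simp] theorem mk_time (l : Tree) (x : Item) (r : Tree) : (mk l x r).time = 13 := by
  simp [mk]

theorem depth_mk (l : Tree) (x : Item) (r : Tree) :
    (mk l x r).val.depth = max l.depth r.depth + 1 := by
  simp [mk]

theorem toList_mk (l : Tree) (x : Item) (r : Tree) :
    (mk l x r).val.toList = l.toList ++ x :: r.toList := by
  simp [mk]

theorem Good.mkNode {l r : Tree} (x : Item) (hl : l.Good) (hr : r.Good)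
    (h₁ : l.depth ≤ r.depth + 1) (h₂ : r.depth ≤ l.depth + 1) : (Tree.mk l x r).val.Good := by
  refine ⟨⟨h₁, h₂, hl.balanced, hr.balanced⟩, ?_, ?_, ?_, hl.augmented, hr.augmented⟩
  · simp [hl.height_val, hr.height_val]
  · simp [hl.size_val, hr.size_val]
    ring
  · simp [hl.total_val, hr.total_val, weight]
    ring

/-! ### Rebalancing and joining -/

theorem toList_balR {l t : Tree} (y : Item) :
    (balR l y t).val.toList = l.toList ++ y :: t.toList := by
  unfold balR
  simp only [Timed.val_bind, Timed.val_ite]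
  split_ifs
  · exact toList_mk ..
  · cases t with
    | nil => exact toList_mk ..
    | node a z b h n s =>
      simp only [Timed.val_bind, Timed.val_ite]
      split_ifs
      · simp [toList_mk]
      · cases a <;> simp [toList_mk]

theorem toList_balL {t r : Tree} (y : Item) :
    (balL t y r).val.toList = t.toList ++ y :: r.toList := by
  unfold balL
  simp only [Timed.val_bind, Timed.val_ite]
  split_ifs
  · exact toList_mk ..
  · cases t with
    | nil => exact toList_mk ..
    | node a z b h n s =>
      simp only [Timed.val_bind, Timed.val_ite]
      split_ifs
      · simp [toList_mk]
      · cases b <;> simp [toList_mk]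

theorem balR_time_le (l : Tree) (y : Item) (t : Tree) : (balR l y t).time ≤ 46 := by
  unfold balR
  simp only [Timed.time_bind, Timed.time_ite, nadd_time, nle_time, height_time]
  split_ifs
  · simp
  · cases t with
    | nil => simp
    | node a z b h n s =>
      simp only [Timed.time_bind, Timed.time_ite, nle_time, height_time]
      split_ifs
      · simp
      · cases a <;> simp

theorem balL_time_le (t : Tree) (y : Item) (r : Tree) : (balL t y r).time ≤ 46 := by
  unfold balL
  simp only [Timed.time_bind, Timed.time_ite, nadd_time, nle_time, height_time]
  split_ifs
  · simp
  · cases t with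
    | nil => simp
    | node a z b h n s =>
      simp only [Timed.time_bind, Timed.time_ite, nle_time, height_time]
      split_ifs
      · simp
      · cases b <;> simp

theorem balR_good {l t : Tree} (y : Item) (hl : l.Good) (ht : t.Good)
    (h₁ : l.depth ≤ t.depth + 1) (h₂ : t.depth ≤ l.depth + 2) :
    (balR l y t).val.Good ∧ max l.depth t.depth ≤ (balR l y t).val.depth ∧
      (balR l y t).val.depth ≤ max l.depth t.depth + 1 ∧
      (t.depth ≤ l.depth + 1 → (balR l y t).val.depth = max l.depth t.depth + 1) := by
  unfold balR
  simp only [Timed.val_bind, Timed.val_ite, nadd_val, nle_val, hl.height_val,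
    ht.height_val]
  split_ifs with h
  · exact ⟨hl.mkNode y ht h₁ h, by rw [depth_mk]; omega, by rw [depth_mk], fun _ => depth_mk ..⟩
  · cases t with
    | nil => simp at h
    | node a z b h n s =>
      have ha := ht.left
      have hb := ht.right
      have hab := ht.left_le
      have hba := ht.right_le
      simp only [Timed.val_bind, Timed.val_ite, nle_val, ha.height_val,
        hb.height_val]
      simp only [depth_node] at *
      split_ifs with h'
      · have hu := hl.mkNode y ha (by omega) (by omega)
        refine ⟨hu.mkNode z hb ?_ ?_, ?_, ?_, ?_⟩ <;> simp only [depth_mk] <;> omega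
      · cases a with
        | nil => simp at h'
        | node a₁ v a₂ =>
          have h₁' := ha.left_le
          have h₂' := ha.right_le
          simp only [depth_node] at *
          have hu := hl.mkNode y ha.left (by omega) (by omega)
          have hv := ha.right.mkNode z hb (by omega) (by omega)
          have e₁ : max a₁.depth a₂.depth = l.depth := by omega
          have e₂ : b.depth = l.depth := by omega
          have e₃ : max l.depth a₁.depth = l.depth := by omega
          clear h₁ h₂ hab hba h' h₁' h₂'
          simp only [Timed.val_bind]
          refine ⟨hu.mkNode v hv ?_ ?_, ?_, ?_, ?_⟩ <;>
            simp only [depth_mk, e₁, e₂, e₃] <;> omega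

theorem balL_good {t r : Tree} (y : Item) (ht : t.Good) (hr : r.Good)
    (h₁ : r.depth ≤ t.depth + 1) (h₂ : t.depth ≤ r.depth + 2) :
    (balL t y r).val.Good ∧ max t.depth r.depth ≤ (balL t y r).val.depth ∧
      (balL t y r).val.depth ≤ max t.depth r.depth + 1 ∧
      (t.depth ≤ r.depth + 1 → (balL t y r).val.depth = max t.depth r.depth + 1) := by
  unfold balL
  simp only [Timed.val_bind, Timed.val_ite, nadd_val, nle_val, hr.height_val,
    ht.height_val]
  split_ifs with h
  · exact ⟨ht.mkNode y hr h h₁, by rw [depth_mk]; omega, by rw [depth_mk], fun _ => depth_mk ..⟩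
  · cases t with
    | nil => simp at h
    | node a z b h n s =>
      have ha := ht.left
      have hb := ht.right
      have hab := ht.left_le
      have hba := ht.right_le
      simp only [Timed.val_bind, Timed.val_ite, nle_val, ha.height_val,
        hb.height_val]
      simp only [depth_node] at *
      split_ifs with h'
      · have hu := hb.mkNode y hr (by omega) (by omega)
        refine ⟨ha.mkNode z hu ?_ ?_, ?_, ?_, ?_⟩ <;> simp only [depth_mk] <;> omega
      · cases b with
        | nil => simp at h'
        | node b₁ v b₂ =>
          have h₁' := hb.left_le
          have h₂' := hb.right_le
          simp only [depth_node] at *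
          have hu := ha.mkNode z hb.left (by omega) (by omega)
          have hv := hb.right.mkNode y hr (by omega) (by omega)
          have e₁ : max b₁.depth b₂.depth = r.depth := by omega
          have e₂ : a.depth = r.depth := by omega
          have e₃ : max a.depth b₁.depth = r.depth := by omega
          have e₄ : max b₂.depth r.depth = r.depth := by omega
          rw [e₂] at e₃
          clear h₁ h₂ hab hba h' h₁' h₂'
          simp only [Timed.val_bind]
          refine ⟨hu.mkNode v hv ?_ ?_, ?_, ?_, ?_⟩ <;>
            simp only [depth_mk, e₁, e₂, e₃, e₄] <;> omega

theorem toList_joinR (l : Tree) (x : Item) (r : Tree) :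
    (joinR l x r).val.toList = l.toList ++ x :: r.toList := by
  induction l with
  | nil => simp [joinR, toList_mk]
  | node ll y lr h n s _ ih =>
    rw [joinR]
    simp only [Timed.val_bind, Timed.val_ite]
    split_ifs
    · exact toList_mk ..
    · simp [toList_balR, ih]

theorem toList_joinL (l : Tree) (x : Item) (r : Tree) :
    (joinL l x r).val.toList = l.toList ++ x :: r.toList := by
  induction r with
  | nil => simp [joinL, toList_mk]
  | node rl y rr h n s ih _ =>
    rw [joinL]
    simp only [Timed.val_bind, Timed.val_ite]
    split_ifs
    · exact toList_mk ..
    · simp [toList_balL, ih]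

theorem joinR_good {l r : Tree} (x : Item) (hl : l.Good) (hr : r.Good)
    (h : r.depth ≤ l.depth) :
    (joinR l x r).val.Good ∧ l.depth ≤ (joinR l x r).val.depth ∧
      (joinR l x r).val.depth ≤ l.depth + 1 ∧
      (joinR l x r).time + 50 * r.depth ≤ 50 * l.depth + 50 := by
  induction l with
  | nil =>
    simp only [depth_nil, Nat.le_zero] at h
    simp only [joinR, depth_mk, mk_time, depth_nil]
    exact ⟨hl.mkNode x hr (by simp) (by omega), by omega, by omega, by omega⟩
  | node ll y lr h' n s _ ih =>
    have h₁ := hl.left_le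
    have h₂ := hl.right_le
    rw [joinR]
    simp only [Timed.val_bind, Timed.val_ite, Timed.time_bind, Timed.time_ite, nadd_val, nle_val,
      nadd_time, nle_time, hl.height_val, hr.height_val, height_time, mk_time]
    split_ifs with hc
    · refine ⟨hl.mkNode x hr hc (by omega), ?_, ?_, ?_⟩
      · rw [depth_mk]; omega
      · rw [depth_mk]; omega
      · omega
    · simp only [depth_node] at *
      obtain ⟨g, hg₁, hg₂, hg₃⟩ := ih hl.right (by omega)
      obtain ⟨g', hg₁', hg₂', hg₃'⟩ := balR_good y hl.left g (by omega) (by omega)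
      have := balR_time_le ll y (joinR lr x r).val
      exact ⟨g', by omega, by omega, by omega⟩

theorem joinL_good {l r : Tree} (x : Item) (hl : l.Good) (hr : r.Good)
    (h : l.depth ≤ r.depth) :
    (joinL l x r).val.Good ∧ r.depth ≤ (joinL l x r).val.depth ∧
      (joinL l x r).val.depth ≤ r.depth + 1 ∧
      (joinL l x r).time + 50 * l.depth ≤ 50 * r.depth + 50 := by
  induction r with
  | nil =>
    simp only [depth_nil, Nat.le_zero] at h
    simp only [joinL, depth_mk, mk_time, depth_nil]
    exact ⟨hl.mkNode x hr (by omega) (by simp), by omega, by omega, by omega⟩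
  | node rl y rr h' n s ih _ =>
    have h₁ := hr.left_le
    have h₂ := hr.right_le
    rw [joinL]
    simp only [Timed.val_bind, Timed.val_ite, Timed.time_bind, Timed.time_ite, nadd_val, nle_val,
      nadd_time, nle_time, hl.height_val, hr.height_val, height_time, mk_time]
    split_ifs with hc
    · refine ⟨hl.mkNode x hr (by omega) hc, ?_, ?_, ?_⟩
      · rw [depth_mk]; omega
      · rw [depth_mk]; omega
      · omega
    · simp only [depth_node] at *
      obtain ⟨g, hg₁, hg₂, hg₃⟩ := ih hr.left (by omega)
      obtain ⟨g', hg₁', hg₂', hg₃'⟩ := balL_good y g hr.right (by omega) (by omega)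
      have := balL_time_le (joinL l x rl).val y rr
      exact ⟨g', by omega, by omega, by omega⟩

theorem toList_join (l : Tree) (x : Item) (r : Tree) :
    (join l x r).val.toList = l.toList ++ x :: r.toList := by
  simp only [join, Timed.val_bind, Timed.val_ite]
  split_ifs
  · exact toList_joinR ..
  · exact toList_joinL ..

theorem join_good {l r : Tree} (x : Item) (hl : l.Good) (hr : r.Good) :
    (join l x r).val.Good ∧ max l.depth r.depth ≤ (join l x r).val.depth ∧
      (join l x r).val.depth ≤ max l.depth r.depth + 1 ∧
      (join l x r).time + 50 * min l.depth r.depth ≤ 50 * max l.depth r.depth + 53 := by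
  simp only [join, Timed.val_bind, Timed.val_ite, Timed.time_bind, Timed.time_ite, nle_val,
    nle_time, hl.height_val, hr.height_val, height_time]
  split_ifs with h
  · obtain ⟨g, h₁, h₂, h₃⟩ := joinR_good x hl hr h
    exact ⟨g, by omega, by omega, by omega⟩
  · obtain ⟨g, h₁, h₂, h₃⟩ := joinL_good x hl hr (by omega)
    exact ⟨g, by omega, by omega, by omega⟩

/-! ### Splitting, concatenation, insertion and deletion -/

theorem split_good {t : Tree} (ht : t.Good) (p : ℕ) :
    (split t p).val.1.Good ∧ (split t p).val.2.Good ∧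
      (split t p).val.1.depth ≤ t.depth ∧ (split t p).val.2.depth ≤ t.depth ∧
      (split t p).time ≤
        50 * (split t p).val.1.depth + 50 * (split t p).val.2.depth + 107 * t.depth + 1 := by
  induction t generalizing p with
  | nil => exact ⟨good_nil, good_nil, by simp [split], by simp [split], by simp [split]⟩
  | node l y r h n s ihl ihr =>
    have h₁ := ht.left_le
    have h₂ := ht.right_le
    rw [split]
    simp only [Timed.val_bind, Timed.val_ite, Timed.time_bind, Timed.time_ite, nle_val, nle_time,
      nadd_val, nadd_time, nsub_val, nsub_time, size_time, ht.left.size_val, Timed.val_pure,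
      Timed.time_pure, depth_node]
    split_ifs with hc
    · obtain ⟨ga, gb, ha, hb, hT⟩ := ihl ht.left p
      obtain ⟨g, k₁, k₂, k₃⟩ := join_good y gb ht.right
      exact ⟨ga, g, by dsimp only; omega, by dsimp only; omega, by dsimp only; omega⟩
    · obtain ⟨ga, gb, ha, hb, hT⟩ := ihr ht.right (p - (l.toList.length + 1))
      obtain ⟨g, k₁, k₂, k₃⟩ := join_good y ht.left ga
      exact ⟨g, gb, by dsimp only; omega, by dsimp only; omega, by dsimp only; omega⟩

theorem toList_split {t : Tree} (ht : t.Good) (p : ℕ) :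
    (split t p).val.1.toList = t.toList.take p ∧ (split t p).val.2.toList = t.toList.drop p := by
  induction t generalizing p with
  | nil => simp [split]
  | node l y r h n s ihl ihr =>
    rw [split]
    simp only [Timed.val_bind, Timed.val_ite, nle_val, nadd_val, nsub_val, ht.left.size_val,
      Timed.val_pure]
    split_ifs with hc
    · obtain ⟨h₁, h₂⟩ := ihl ht.left p
      simp only [h₁, toList_join, h₂, toList_node]
      constructor
      · rw [List.take_append_of_le_length hc]
      · rw [List.drop_append_of_le_length hc]
    · obtain ⟨h₁, h₂⟩ := ihr ht.right (p - (l.toList.length + 1))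
      obtain ⟨q, rfl⟩ : ∃ q, p = l.toList.length + (q + 1) :=
        ⟨p - (l.toList.length + 1), by omega⟩
      simp only [show l.toList.length + (q + 1) - (l.toList.length + 1) = q by omega] at *
      simp [h₁, toList_join, h₂, List.take_append, List.drop_append]

theorem popFirst_good {l r : Tree} {x : Item} {h n : ℕ} {s : ℝ} (ht : (node l x r h n s).Good) :
    (popFirst l x r).val.1 :: (popFirst l x r).val.2.toList = l.toList ++ x :: r.toList ∧
      (popFirst l x r).val.2.Good ∧
      (popFirst l x r).val.2.depth ≤ max l.depth r.depth + 1 ∧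
      (popFirst l x r).time ≤
        50 * (popFirst l x r).val.2.depth + 103 * (max l.depth r.depth + 1) := by
  induction l generalizing x r h n s with
  | nil => exact ⟨rfl, ht.right, by simp [popFirst], by simp [popFirst]; omega⟩
  | node ll y lr h' n' s' ih _ =>
    have h₁ := ht.left_le
    have h₂ := ht.right_le
    obtain ⟨hL, g, hd, hT⟩ := ih ht.left
    obtain ⟨g', k₁, k₂, k₃⟩ := join_good x g ht.right
    rw [popFirst]
    simp only [depth_node] at *
    simp only [Timed.val_bind, Timed.time_bind, Timed.val_pure, Timed.time_pure, toList_join]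
    refine ⟨?_, g', by omega, by omega⟩
    rw [toList_node, ← hL]
    simp

theorem concat_good {a b : Tree} {D : ℕ} (ha : a.Good) (hb : b.Good) (hda : a.depth ≤ D)
    (hdb : b.depth ≤ D) :
    (concat a b).val.toList = a.toList ++ b.toList ∧ (concat a b).val.Good ∧
      (concat a b).time ≤ 203 * D + 54 := by
  cases b with
  | nil => exact ⟨by simp [concat], ha, by simp [concat]⟩
  | node l x r h n s =>
    obtain ⟨hL, g, hd, hT⟩ := popFirst_good hb
    obtain ⟨g', k₁, k₂, k₃⟩ := join_good (popFirst l x r).val.1 ha g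
    simp only [depth_node] at hdb
    simp only [concat, Timed.val_bind, Timed.time_bind, toList_join]
    exact ⟨by rw [hL, toList_node], g', by omega⟩

theorem insertAt_good {t : Tree} {D : ℕ} (ht : t.Good) (hD : t.depth ≤ D) (p : ℕ) (x : Item) :
    (insertAt t p x).val.toList = t.toList.take p ++ x :: t.toList.drop p ∧
      (insertAt t p x).val.Good ∧ (insertAt t p x).time ≤ 257 * D + 54 := by
  obtain ⟨ga, gb, ha, hb, hT⟩ := split_good ht p
  obtain ⟨h₁, h₂⟩ := toList_split ht p
  obtain ⟨g', k₁, k₂, k₃⟩ := join_good x ga gb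
  simp only [insertAt, Timed.val_bind, Timed.time_bind, toList_join]
  exact ⟨by rw [h₁, h₂], g', by omega⟩

theorem deleteAt_good {t : Tree} {D : ℕ} (ht : t.Good) (hD : t.depth ≤ D) (p : ℕ) :
    (deleteAt t p).val.toList = t.toList.eraseIdx p ∧
      (deleteAt t p).val.Good ∧ (deleteAt t p).time ≤ 563 * D + 56 := by
  obtain ⟨ga, gb, ha, hb, hT⟩ := split_good ht p
  obtain ⟨h₁, h₂⟩ := toList_split ht p
  rw [List.eraseIdx_eq_take_drop_succ, ← h₁, ← List.drop_drop, ← h₂]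
  simp only [deleteAt, Timed.val_bind, Timed.time_bind]
  generalize (split t p).val.2 = b at *
  cases b with
  | nil => exact ⟨by simp, ga, by simp at *; omega⟩
  | node l x r h n s =>
    obtain ⟨hL, g, hd, hT'⟩ := popFirst_good gb
    simp only [depth_node] at hb hT
    obtain ⟨h₁', g', hT''⟩ := concat_good (D := D) ga g (by omega) (by omega)
    simp only [Timed.val_bind, Timed.time_bind]
    refine ⟨?_, g', by omega⟩
    rw [h₁', toList_node, ← hL]
    simp

/-- The search stops between an item that passes the test and one that does not. -/
theorem search_spec (test : ℕ → ℝ → ℝ → Timed Bool) {t : Tree} (ht : t.Good) (c : ℕ) (s : ℝ) :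
    ∃ A B, t.toList = A ++ B ∧ (search test t c s).val = (c + A.length, s + weight A) ∧
      (∀ A' x, A = A' ++ [x] → (test (c + A.length) (s + weight A) x.w).val = true) ∧
      (∀ x B', B = x :: B' → ¬(test (c + A.length + 1) (s + weight A + x.w) x.w).val = true) := by
  induction t generalizing c s with
  | nil => exact ⟨[], [], rfl, by simp [search], by simp, by simp⟩
  | node l y r h n σ ihl ihr =>
    rw [search]
    simp only [Timed.val_bind, Timed.val_ite, ht.left.size_val, ht.left.total_val, nadd_val,
      radd_val]
    split_ifs with hc
    · obtain ⟨A, B, hL, hv, hA, hB⟩ := ihr ht.right (c + l.toList.length + 1)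
        (s + weight l.toList + y.w)
      have e₁ : c + (l.toList ++ y :: A).length = c + l.toList.length + 1 + A.length := by
        simp; ring
      have e₂ : s + weight (l.toList ++ y :: A) = s + weight l.toList + y.w + weight A := by
        simp; ring
      refine ⟨l.toList ++ y :: A, B, by simp [hL], by rw [hv, e₁, e₂], ?_, ?_⟩
      · intro A' x hx
        rw [e₁, e₂]
        rcases List.eq_nil_or_concat A with rfl | ⟨A₂, z, rfl⟩
        · obtain ⟨-, rfl⟩ : l.toList = A' ∧ y = x := by simpa using hx
          simpa using hc
        · rw [List.concat_eq_append] at *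
          obtain rfl : z = x := by
            have : (l.toList ++ y :: A₂) ++ [z] = A' ++ [x] := by simpa using hx
            simpa using (List.append_inj' this rfl).2
          exact hA A₂ z rfl
      · intro x B' hx
        rw [e₁, e₂]
        exact hB x B' hx
    · obtain ⟨A, B, hL, hv, hA, hB⟩ := ihl ht.left c s
      refine ⟨A, B ++ y :: r.toList, by simp [hL], hv, hA, ?_⟩
      intro x B' hx
      cases B with
      | nil =>
        obtain ⟨rfl, -⟩ : y = x ∧ r.toList = B' := by simpa using hx
        simpa [hL] using hc
      | cons z B₂ =>
        obtain ⟨rfl, -⟩ : z = x ∧ B₂ ++ y :: r.toList = B' := by simpa using hx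
        exact hB z B₂ rfl

theorem search_time_le {test : ℕ → ℝ → ℝ → Timed Bool} {q : ℕ}
    (hq : ∀ c s w, (test c s w).time ≤ q) (t : Tree) (c : ℕ) (s : ℝ) :
    (search test t c s).time ≤ (q + 6) * t.depth + 1 := by
  induction t generalizing c s with
  | nil => simp [search]
  | node l y r h n σ ihl ihr =>
    rw [search]
    simp only [Timed.time_bind, Timed.time_ite, size_time, total_time, nadd_time, radd_time,
      depth_node]
    have hm₁ : (q + 6) * l.depth ≤ (q + 6) * max l.depth r.depth :=
      Nat.mul_le_mul_left _ (le_max_left _ _)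
    have hm₂ : (q + 6) * r.depth ≤ (q + 6) * max l.depth r.depth :=
      Nat.mul_le_mul_left _ (le_max_right _ _)
    rw [Nat.mul_succ]
    split_ifs with hc
    · exact (Nat.add_le_add_left (Nat.add_le_add_left (Nat.add_le_add_left
        (Nat.add_le_add_left (Nat.add_le_add_left (Nat.add_le_add_left
        (Nat.add_le_add (hq _ _ _) (ihr _ _)) _) _) _) _) _) _).trans (by omega)
    · exact (Nat.add_le_add_left (Nat.add_le_add_left (Nat.add_le_add_left
        (Nat.add_le_add_left (Nat.add_le_add_left (Nat.add_le_add_left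
        (Nat.add_le_add (hq _ _ _) (ihl _ _)) _) _) _) _) _) _).trans (by omega)

/-- The height of a balanced tree is logarithmic in the number of items. -/
theorem two_pow_depth_le {t : Tree} (ht : t.Balanced) :
    2 ^ t.depth ≤ (t.toList.length + 1) ^ 2 := by
  induction t with
  | nil => simp
  | node l y r h n s ihl ihr =>
    have key : ∀ a b d e : ℕ, 2 ^ d ≤ a ^ 2 → 2 ^ e ≤ b ^ 2 → d ≤ e + 1 →
        2 ^ (d + 1) ≤ (a + b) ^ 2 := by
      intro a b d e ha hb hde
      have h₁ : 2 ^ d ≤ 2 * b ^ 2 :=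
        (Nat.pow_le_pow_right (by norm_num) hde).trans (by rw [pow_succ]; omega)
      have h₂ : 2 ^ d ≤ 2 * a * b := by
        refine (Nat.pow_le_pow_iff_left two_ne_zero).1 ?_
        nlinarith [Nat.mul_le_mul ha h₁]
      rw [pow_succ]
      nlinarith
    obtain ⟨h₁, h₂, hl, hr⟩ := ht
    have e : (node l y r h n s).toList.length + 1 =
        (l.toList.length + 1) + (r.toList.length + 1) := by simp; ring
    rw [e, depth_node]
    rcases le_total r.depth l.depth with h | h
    · rw [max_eq_left h]
      exact key _ _ _ _ (ihl hl) (ihr hr) h₁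
    · rw [max_eq_right h, add_comm (_ + 1)]
      exact key _ _ _ _ (ihr hr) (ihl hl) h₂

end Tree

/-! ### Lists of items with adjusted weights -/

/-- Total adjusted weight. -/
def adjSum (l : List (ℕ × ℝ)) : ℝ := (l.map Prod.snd).sum

@[simp] theorem adjSum_nil : adjSum [] = 0 := rfl

@[simp] theorem adjSum_cons (p : ℕ × ℝ) (l : List (ℕ × ℝ)) :
    adjSum (p :: l) = p.2 + adjSum l := by
  simp [adjSum]

@[simp] theorem adjSum_append (l m : List (ℕ × ℝ)) : adjSum (l ++ m) = adjSum l + adjSum m := by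
  simp [adjSum]

/-- An item with its original weight. -/
def Item.plain (x : Item) : ℕ × ℝ := (x.id, x.w)

/-- An item with adjusted weight `θ`. -/
def Item.withWeight (θ : ℝ) (x : Item) : ℕ × ℝ := (x.id, θ)

@[simp] theorem Item.plain_fst (x : Item) : x.plain.1 = x.id := rfl

@[simp] theorem Item.plain_snd (x : Item) : x.plain.2 = x.w := rfl

@[simp] theorem Item.withWeight_fst (θ : ℝ) (x : Item) : (x.withWeight θ).1 = x.id := rfl

@[simp] theorem Item.withWeight_snd (θ : ℝ) (x : Item) : (x.withWeight θ).2 = θ := rfl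

@[simp] theorem adjSum_map_plain (l : List Item) : adjSum (l.map Item.plain) = weight l := by
  induction l with
  | nil => rfl
  | cons x l ih => simp [ih]

@[simp] theorem adjSum_map_withWeight (θ : ℝ) (l : List Item) :
    adjSum (l.map (Item.withWeight θ)) = l.length * θ := by
  induction l with
  | nil => simp
  | cons x l ih => simp [ih]; ring

theorem State.sample_eq (st : State) : st.sample =
    st.small.toList.map (Item.withWeight st.thr) ++ st.large.toList.map Item.plain := rfl

/-- The total of `τ - a` over the adjusted weights `a`. -/
def gap (τ : ℝ) (l : List (ℕ × ℝ)) : ℝ := l.length * τ - adjSum l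

@[simp] theorem gap_nil (τ : ℝ) : gap τ [] = 0 := by simp [gap]

@[simp] theorem gap_append (τ : ℝ) (l m : List (ℕ × ℝ)) :
    gap τ (l ++ m) = gap τ l + gap τ m := by
  simp [gap]; ring

theorem gap_cons (τ : ℝ) (p : ℕ × ℝ) (l : List (ℕ × ℝ)) :
    gap τ (p :: l) = τ - p.2 + gap τ l := by
  simp [gap]; ring

theorem gap_nonneg {τ : ℝ} {l : List (ℕ × ℝ)} (h : ∀ p ∈ l, p.2 ≤ τ) : 0 ≤ gap τ l := by
  induction l with
  | nil => simp
  | cons p l ih =>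
    rw [gap_cons]
    have h₁ := h p (by simp)
    have h₂ := ih fun q hq => h q (by simp [hq])
    linarith

theorem gap_take_mono {τ : ℝ} {l : List (ℕ × ℝ)} {m n : ℕ} (hmn : m ≤ n)
    (h : ∀ p ∈ l.take n, p.2 ≤ τ) : gap τ (l.take m) ≤ gap τ (l.take n) := by
  rw [← List.take_append_drop m (l.take n), gap_append, List.take_take, min_eq_left hmn]
  have := gap_nonneg (τ := τ) (l := (l.take n).drop m) fun p hp => h p (List.mem_of_mem_drop hp)
  linarith

theorem adjSum_nonneg {l : List (ℕ × ℝ)} (h : ∀ p ∈ l, 0 < p.2) : 0 ≤ adjSum l := by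
  have := gap_nonneg (τ := 0) (l := l.map fun p => (p.1, -p.2)) (by
    simp only [List.mem_map]
    rintro _ ⟨p, hp, rfl⟩
    simpa using (h p hp).le)
  have e : ∀ l : List (ℕ × ℝ), adjSum (l.map fun p => (p.1, -p.2)) = -adjSum l := by
    intro l
    induction l with
    | nil => simp
    | cons p l ih => simp [ih]; ring
  simpa [gap, e] using this

theorem adjSum_pos {l : List (ℕ × ℝ)} (h : ∀ p ∈ l, 0 < p.2) (hl : l ≠ []) : 0 < adjSum l := by
  cases l with
  | nil => exact absurd rfl hl
  | cons p l =>
    have h₁ := h p (by simp)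
    have h₂ := adjSum_nonneg (l := l) fun q hq => h q (by simp [hq])
    rw [adjSum_cons]
    linarith

/-- The threshold determined by the adjusted weights `U` that are to be cut. -/
theorem threshold_spec {U B : List (ℕ × ℝ)} (hUpos : ∀ u ∈ U, 0 < u.2) (hBpos : ∀ b ∈ B, 0 < b.2)
    (hlen : 2 ≤ U.length + B.length)
    (hU : ∀ u ∈ U, ((U.length - 1 : ℕ) : ℝ) * u.2 ≤ adjSum U)
    (hB : ∀ b ∈ B, adjSum U + b.2 < U.length * b.2) {τ : ℝ}
    (hτ : τ = adjSum U / ((U.length - 1 : ℕ) : ℝ)) :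
    0 < τ ∧ (∀ u ∈ U, u.2 ≤ τ) ∧ (∀ b ∈ B, τ < b.2) ∧ gap τ U = τ ∧ 2 ≤ U.length := by
  have h2 : 2 ≤ U.length := by
    by_contra hlt
    have hne : B ≠ [] := by rintro rfl; simp at hlen; omega
    obtain ⟨b, hb⟩ := List.exists_mem_of_ne_nil B hne
    have h₁ := hB b hb
    have h₂ := adjSum_nonneg hUpos
    have h₃ := hBpos b hb
    have h₄ : (U.length : ℝ) ≤ 1 := by exact_mod_cast (by omega : U.length ≤ 1)
    nlinarith
  have hc : ((U.length - 1 : ℕ) : ℝ) = U.length - 1 := by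
    rw [Nat.cast_sub (by omega)]; simp
  have hpos : (0 : ℝ) < U.length - 1 := by
    have : (2 : ℝ) ≤ U.length := by exact_mod_cast h2
    linarith
  rw [hc] at hτ hU
  have hmul : τ * (U.length - 1) = adjSum U := by rw [hτ]; field_simp
  refine ⟨?_, ?_, ?_, ?_, h2⟩
  · rw [hτ]
    exact div_pos (adjSum_pos hUpos (by rintro rfl; simp at h2)) hpos
  · intro u hu
    rw [hτ, le_div_iff₀ hpos]
    linarith [hU u hu]
  · intro b hb
    rw [hτ, div_lt_iff₀ hpos]
    linarith [hB b hb]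
  · rw [gap]
    linarith

/-! ### Classifying the new item -/

theorem insertSorted_spec {t : Tree} {D : ℕ} (ht : t.Good) (hD : t.depth ≤ D)
    (hs : (t.toList.map Item.w).Pairwise (· ≤ ·)) (x : Item) :
    (insertSorted t x).val.Good ∧ (insertSorted t x).val.toList.Perm (x :: t.toList) ∧
      ((insertSorted t x).val.toList.map Item.w).Pairwise (· ≤ ·) ∧
      (insertSorted t x).time ≤ 264 * D + 55 := by
  obtain ⟨A, B, hL, hv, hA, hB⟩ := Tree.search_spec (fun _ _ w => rle w x.w) ht 0 0
  obtain ⟨hl, hg, hT⟩ := Tree.insertAt_good ht hD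
    (t.search (fun _ _ w => rle w x.w) 0 0).val.1 x
  have hT' := Tree.search_time_le (test := fun _ _ w => rle w x.w) (q := 1) (by simp) t 0 0
  simp only [insertSorted, Timed.val_bind, Timed.time_bind]
  refine ⟨hg, ?_, ?_, by omega⟩
  · rw [hl]
    refine List.perm_middle.trans ?_
    rw [List.take_append_drop]
  · rw [hl, hv, hL]
    simp only [zero_add, List.take_left, List.drop_left]
    rw [hL] at hs
    simp only [List.map_append, List.map_cons, List.pairwise_append, List.pairwise_cons,
      List.mem_map, List.mem_cons, forall_exists_index, and_imp, forall_apply_eq_imp_iff₂] at hs ⊢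
    have hA' : ∀ a ∈ A, a.w ≤ x.w := by
      rcases List.eq_nil_or_concat A with rfl | ⟨A₂, z, rfl⟩
      · simp
      · rw [List.concat_eq_append] at *
        have hz : z.w ≤ x.w := by simpa using hA A₂ z rfl
        intro a ha
        rcases List.mem_append.1 ha with ha | ha
        · refine le_trans ?_ hz
          have := hs.1
          rw [List.map_append, List.pairwise_append] at this
          exact this.2.2 _ (List.mem_map_of_mem ha) _ (by simp)
        · rw [List.mem_singleton.1 ha]; exact hz
    have hB' : ∀ b ∈ B, x.w ≤ b.w := by
      cases B with
      | nil => simp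
      | cons z B₂ =>
        have hz : x.w < z.w := by simpa using hB z B₂ rfl
        have := hs.2.1
        rw [List.map_cons, List.pairwise_cons] at this
        intro b hb
        rcases List.mem_cons.1 hb with rfl | hb
        · exact hz.le
        · exact hz.le.trans (this.1 _ (List.mem_map_of_mem hb))
    refine ⟨hs.1, ⟨hB', hs.2.1⟩, ?_⟩
    intro a ha b hb
    rcases hb with rfl | ⟨b, hb, rfl⟩
    · exact hA' a ha
    · exact hs.2.2 a ha b hb

/-- The new item, if it is small. -/
def fresh (st : State) (x : Item) : List Item :=
  open Classical in if x.w ≤ st.thr then [x] else []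

theorem prepare_spec {st : State} {D : ℕ} (hl : st.large.Good) (hs : st.small.Good)
    (hD : st.large.depth ≤ D)
    (hsort : (st.large.toList.map Item.w).Pairwise (· ≤ ·)) (x : Item) :
    (prepare st x).val.large.Good ∧
      ((prepare st x).val.large.toList.map Item.w).Pairwise (· ≤ ·) ∧
      (fresh st x ++ (prepare st x).val.large.toList).Perm (x :: st.large.toList) ∧
      ((prepare st x).val.isSmall = true ↔ x.w ≤ st.thr) ∧
      (prepare st x).val.count = (fresh st x).length + st.small.toList.length ∧
      (prepare st x).val.sum = weight (fresh st x) + st.small.toList.length * st.thr ∧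
      (prepare st x).time ≤ 264 * D + 61 := by
  obtain ⟨h₁, h₂, h₃, h₄⟩ := insertSorted_spec hl hD hsort x
  simp only [prepare, Timed.val_bind, Timed.time_bind, Timed.val_ite, Timed.time_ite, rle_val,
    hs.size_val, toReal_val, rmul_val, nadd_val, radd_val, Timed.val_pure, Timed.time_pure,
    rle_time, Tree.size_time, toReal_time, rmul_time, nadd_time, radd_time, fresh]
  split_ifs with h
  · refine ⟨hl, hsort, List.Perm.refl _, by simp [h], by simp; ring, by simp; ring, by omega⟩
  · refine ⟨h₁, h₃, h₂, by simpa using h, by simp, by simp, by omega⟩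

/-- The small items of the reservoir and the new item, in the order used for dropping. -/
def smallItems (st : State) (x : Item) : List Item := fresh st x ++ st.small.toList

/-- The same items with their adjusted weights. -/
def smallSample (st : State) (x : Item) : List (ℕ × ℝ) :=
  (fresh st x).map Item.plain ++ st.small.toList.map (Item.withWeight st.thr)

@[simp] theorem length_smallSample (st : State) (x : Item) :
    (smallSample st x).length = (fresh st x).length + st.small.toList.length := by
  simp [smallSample]

@[simp] theorem adjSum_smallSample (st : State) (x : Item) :
    adjSum (smallSample st x) = weight (fresh st x) + st.small.toList.length * st.thr := by
  simp [smallSample]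

theorem fresh_length_le (st : State) (x : Item) : (fresh st x).length ≤ 1 := by
  unfold fresh; split_ifs <;> simp

theorem eq_of_mem_fresh {st : State} {x y : Item} (h : y ∈ fresh st x) :
    y = x ∧ x.w ≤ st.thr := by
  unfold fresh at h
  split_ifs at h with hx
  · exact ⟨by simpa using h, hx⟩
  · simp at h

theorem smallSample_le {st : State} {x : Item} {u : ℕ × ℝ} (h : u ∈ smallSample st x) :
    u.2 ≤ st.thr := by
  rcases List.mem_append.1 h with h | h
  · obtain ⟨y, hy, rfl⟩ := List.mem_map.1 h
    obtain ⟨rfl, hx⟩ := eq_of_mem_fresh hy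
    exact hx
  · obtain ⟨y, hy, rfl⟩ := List.mem_map.1 h
    exact le_rfl

/-! ### The threshold -/

/-- The number and the total weight found by `findCut` mark the items to be cut. -/
theorem findCut_spec {pre : Pre} {U₀ : List (ℕ × ℝ)} {θ : ℝ} {D : ℕ} (hg : pre.large.Good)
    (hD : pre.large.depth ≤ D) (hsort : (pre.large.toList.map Item.w).Pairwise (· ≤ ·))
    (hcount : pre.count = U₀.length) (hsum : pre.sum = adjSum U₀)
    (hU₀ : ∀ u ∈ U₀, 0 < u.2 ∧ u.2 ≤ θ) (hθ : 0 ≤ θ)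
    (hU₀sum : ((U₀.length - 1 : ℕ) : ℝ) * θ ≤ adjSum U₀)
    (hlarge : ∀ y ∈ pre.large.toList, θ < y.w)
    (hlen : 2 ≤ U₀.length + pre.large.toList.length) :
    (findCut pre).time ≤ 10 * D + 1 ∧
    ∃ A B, pre.large.toList = A ++ B ∧ (findCut pre).val.1 = pre.count + A.length ∧
      ∃ τ, τ = (findCut pre).val.2 / (((findCut pre).val.1 - 1 : ℕ) : ℝ) ∧ 0 < τ ∧
        (∀ u ∈ U₀ ++ A.map Item.plain, u.2 ≤ τ) ∧ (∀ b ∈ B, τ < b.w) ∧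
        gap τ (U₀ ++ A.map Item.plain) = τ ∧ 2 ≤ (U₀ ++ A.map Item.plain).length := by
  constructor
  · refine (Tree.search_time_le (q := 4) (by simp) _ _ _).trans ?_
    omega
  obtain ⟨A, B, hL, hv, hA, hB⟩ := Tree.search_spec
    (fun c s w => do
      let c' ← nsub c 1
      let cr ← toReal c'
      let a ← rmul cr w
      rle a s) hg pre.count pre.sum
  replace hv : (findCut pre).val = (pre.count + A.length, pre.sum + weight A) := hv
  simp only [Timed.val_bind, nsub_val, toReal_val, rmul_val, rle_val, hcount, hsum] at hA hB
  refine ⟨A, B, hL, by rw [hv], _, rfl, ?_⟩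
  rw [hL] at hsort hlarge hlen
  rw [List.map_append, List.pairwise_append] at hsort
  obtain ⟨hsA, hsB, -⟩ := hsort
  set U := U₀ ++ A.map Item.plain with hU
  have hUlen : U.length = U₀.length + A.length := by simp [hU]
  have hUsum : adjSum U = adjSum U₀ + weight A := by simp [hU]
  have hUpos : ∀ u ∈ U, 0 < u.2 := by
    intro u hu
    rcases List.mem_append.1 hu with hu | hu
    · exact (hU₀ u hu).1
    · obtain ⟨y, hy, rfl⟩ := List.mem_map.1 hu
      exact hθ.trans_lt (hlarge y (by simp [hy]))
  have key := threshold_spec (U := U) (B := B.map Item.plain)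
    (τ := (findCut pre).val.2 / (((findCut pre).val.1 - 1 : ℕ) : ℝ)) hUpos ?_ ?_ ?_ ?_ ?_
  · obtain ⟨h₁, h₂, h₃, h₄⟩ := key
    exact ⟨h₁, h₂, fun b hb => h₃ b.plain (List.mem_map_of_mem hb), h₄⟩
  · intro b hb
    obtain ⟨y, hy, rfl⟩ := List.mem_map.1 hb
    exact hθ.trans_lt (hlarge y (by simp [hy]))
  · simp only [List.length_append, List.length_map] at hlen ⊢
    omega
  · rw [hUlen, hUsum]
    rcases List.eq_nil_or_concat A with rfl | ⟨A₂, z, rfl⟩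
    · intro u hu
      simp only [hU, List.map_nil, List.append_nil, List.length_nil, weight_nil,
        add_zero] at hu ⊢
      exact (mul_le_mul_of_nonneg_left (hU₀ u hu).2 (Nat.cast_nonneg _)).trans hU₀sum
    · rw [List.concat_eq_append] at *
      intro u hu
      refine (mul_le_mul_of_nonneg_left ?_ (Nat.cast_nonneg _)).trans (hA A₂ z rfl)
      rcases List.mem_append.1 hu with hu | hu
      · exact (hU₀ u hu).2.trans (hlarge z (by simp)).le
      · obtain ⟨y, hy, rfl⟩ := List.mem_map.1 hu
        rcases (by simpa using hy : y ∈ A₂ ∨ y = z) with hy | rfl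
        · rw [List.map_append, List.pairwise_append] at hsA
          exact hsA.2.2 _ (List.mem_map_of_mem hy) _ (by simp)
        · exact le_rfl
  · cases B with
    | nil => simp
    | cons z B₂ =>
      have hz := hB z B₂ rfl
      rw [not_le, ← hUlen, ← hUsum, Nat.add_sub_cancel] at hz
      have hz₀ : 0 < z.w := hθ.trans_lt (hlarge z (by simp))
      have hn : 0 ≤ adjSum U := adjSum_nonneg hUpos
      have h1 : (1 : ℝ) < U.length := by
        by_contra h1
        have := mul_le_mul_of_nonneg_right (not_lt.1 h1) hz₀.le
        linarith
      rw [List.map_cons, List.pairwise_cons] at hsB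
      intro b hb
      have hzb : z.w ≤ b.2 := by
        rcases List.mem_map.1 hb with ⟨y, hy, rfl⟩
        rcases List.mem_cons.1 hy with rfl | hy
        · exact le_rfl
        · exact hsB.1 _ (List.mem_map_of_mem hy)
      nlinarith
  · rw [hv, hUlen, hUsum, hcount, hsum]

/-! ### The item to drop -/

/-- In `U`, the total of `τ - a` first reaches `ρ` at the item with `p` items in front of it. -/
def CrossesAt (τ ρ : ℝ) (U : List (ℕ × ℝ)) (p : ℕ) : Prop :=
  p < U.length ∧ gap τ (U.take p) < ρ ∧ ρ ≤ gap τ (U.take (p + 1))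

theorem crossesAt_of_eq {τ ρ : ℝ} {U Q Q' : List (ℕ × ℝ)} {y : ℕ × ℝ} {p : ℕ}
    (hU : U = Q ++ y :: Q') (hp : p = Q.length) (h₁ : gap τ Q < ρ) (h₂ : ρ ≤ gap τ (Q ++ [y])) :
    CrossesAt τ ρ U p := by
  subst hU hp
  refine ⟨by simp, by simpa using h₁, ?_⟩
  rwa [List.append_cons, List.take_left' (by simp)]

theorem excess_val (τ : ℝ) (c : ℕ) (s : ℝ) : (excess τ c s).val = c * τ - s := by
  simp [excess]

theorem excess_time (τ : ℝ) (c : ℕ) (s : ℝ) : (excess τ c s).time = 3 := by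
  simp [excess]

theorem findDropOld_time_le (st : State) (pre : Pre) (τ ρ : ℝ) (c₀ : ℕ) (a₀ : ℝ) {D : ℕ}
    (hs : st.small.depth ≤ D) (hl : pre.large.depth ≤ D) :
    (findDropOld st pre τ ρ c₀ a₀).time ≤ 14 * D + 5 := by
  simp only [findDropOld, Timed.time_bind, Timed.time_ite, excess_time, rle_time, Timed.time_pure]
  split_ifs
  · have := Tree.search_time_le (test := fun c _ _ => do
        let m ← nsub c c₀
        let mr ← toReal m
        let a ← rmul mr st.thr
        let s ← radd a₀ a
        let v ← excess τ c s
        rlt v ρ) (q := 8) (by simp [excess_time]) st.small c₀ 0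
    omega
  · have := Tree.search_time_le (test := fun c s w => do
        let below ← rle w τ
        if below then do
          let v ← excess τ c s
          rlt v ρ
        else pure false) (q := 5) (by
          intro c s w
          simp only [Timed.time_bind, Timed.time_ite, excess_time, rle_time, rlt_time,
            Timed.time_pure]
          split_ifs <;> simp) pre.large pre.count pre.sum
    omega

theorem findDrop_time_le (st : State) (x : Item) (pre : Pre) (τ r : ℝ) {D : ℕ}
    (hs : st.small.depth ≤ D) (hl : pre.large.depth ≤ D) :
    (findDrop st x pre τ r).time ≤ 14 * D + 8 := by
  have h₁ := findDropOld_time_le st pre τ (r * τ) 1 x.w hs hl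
  have h₂ := findDropOld_time_le st pre τ (r * τ) 0 0 hs hl
  simp only [findDrop, Timed.time_bind, Timed.time_ite, rmul_time, rsub_time, rle_time,
    Timed.time_step, rmul_val]
  split_ifs <;> omega

theorem findDropOld_spec {st : State} {pre : Pre} {F A B : List Item} {τ ρ : ℝ}
    (hs : st.small.Good) (hl : pre.large.Good)
    (hsort : (pre.large.toList.map Item.w).Pairwise (· ≤ ·))
    (hcount : pre.count = F.length + st.small.toList.length)
    (hsum : pre.sum = weight F + st.small.toList.length * st.thr)
    (hAB : pre.large.toList = A ++ B) (hA : ∀ a ∈ A, a.w ≤ τ) (hB : ∀ b ∈ B, τ < b.w)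
    (hF : gap τ (F.map Item.plain) < ρ) (hρ : ρ ≤ gap τ (F.map Item.plain ++
      st.small.toList.map (Item.withWeight st.thr) ++ A.map Item.plain)) :
    CrossesAt τ ρ (F.map Item.plain ++ st.small.toList.map (Item.withWeight st.thr) ++
      A.map Item.plain) (findDropOld st pre τ ρ F.length (weight F)).val := by
  have hgap : gap τ (F.map Item.plain ++ st.small.toList.map (Item.withWeight st.thr)) =
      pre.count * τ - pre.sum := by simp [gap, hcount, hsum]
  simp only [findDropOld, Timed.val_bind, Timed.val_ite, excess_val, rle_val, Timed.val_pure]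
  rw [← hgap]
  split_ifs with h
  · obtain ⟨A', B', hL, hv, hA', hB'⟩ := Tree.search_spec (fun c _ _ => do
        let m ← nsub c F.length
        let mr ← toReal m
        let a ← rmul mr st.thr
        let s ← radd (weight F) a
        let v ← excess τ c s
        rlt v ρ) hs F.length 0
    rw [hv]
    simp only [Timed.val_bind, nsub_val, toReal_val, rmul_val, radd_val, excess_val,
      rlt_val] at hA' hB'
    have hlt : gap τ (F.map Item.plain ++ A'.map (Item.withWeight st.thr)) < ρ := by
      rcases List.eq_nil_or_concat A' with rfl | ⟨A₂, z, rfl⟩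
      · simpa using hF
      · rw [List.concat_eq_append] at *
        have := hA' A₂ z rfl
        simp [gap] at this ⊢
        linarith
    cases B' with
    | nil =>
      rw [List.append_nil] at hL
      rw [hL] at h
      exact absurd h (not_le.2 hlt)
    | cons y B₂ =>
      refine crossesAt_of_eq (Q := F.map Item.plain ++ A'.map (Item.withWeight st.thr))
        (y := y.withWeight st.thr) (Q' := B₂.map (Item.withWeight st.thr) ++ A.map Item.plain)
        ?_ ?_ hlt ?_
      · simp [hL]
      · simp
      · have := hB' y B₂ rfl
        rw [not_lt] at this
        refine this.trans (le_of_eq ?_)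
        rw [show F.length + A'.length + 1 - F.length = A'.length + 1 by omega]
        simp [gap]
        ring
  · obtain ⟨A', B', hL, hv, hA', hB'⟩ := Tree.search_spec (fun c s w => do
        let below ← rle w τ
        if below then do
          let v ← excess τ c s
          rlt v ρ
        else pure false) hl pre.count pre.sum
    rw [hv]
    simp only [Timed.val_bind, Timed.val_ite, rle_val, excess_val,
      Timed.val_pure] at hA' hB'
    rw [hL, List.map_append, List.pairwise_append] at hsort
    obtain ⟨hsA, hsB, -⟩ := hsort
    have hlt : gap τ (F.map Item.plain ++ st.small.toList.map (Item.withWeight st.thr) ++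
        A'.map Item.plain) < ρ ∧ ∀ a ∈ A', a.w ≤ τ := by
      rcases List.eq_nil_or_concat A' with rfl | ⟨A₂, z, rfl⟩
      · simpa using h
      · rw [List.concat_eq_append] at *
        have hz := hA' A₂ z rfl
        split_ifs at hz with hzτ
        · simp only [rlt_val] at hz
          constructor
          · rw [gap_append, hgap]
            simp [gap] at hz ⊢
            linarith
          · rw [List.map_append, List.pairwise_append] at hsA
            intro a ha
            rcases List.mem_append.1 ha with ha | ha
            · exact (hsA.2.2 _ (List.mem_map_of_mem ha) _ (by simp)).trans hzτ
            · rw [List.mem_singleton.1 ha]; exact hzτ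
    obtain ⟨hlt, hA'τ⟩ := hlt
    have hB'ne : ∃ y B₂, B' = y :: B₂ ∧ y.w ≤ τ := by
      by_contra hcon
      have hB'τ : ∀ b ∈ B', τ < b.w := by
        cases B' with
        | nil => simp
        | cons y B₂ =>
          have hy : τ < y.w := by
            by_contra hy
            exact hcon ⟨y, B₂, rfl, not_lt.1 hy⟩
          rw [List.map_cons, List.pairwise_cons] at hsB
          intro b hb
          rcases List.mem_cons.1 hb with rfl | hb
          · exact hy
          · exact hy.trans_le (hsB.1 _ (List.mem_map_of_mem hb))
      have hfilter : ∀ X Y : List Item, (∀ a ∈ X, a.w ≤ τ) → (∀ b ∈ Y, τ < b.w) →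
          (X ++ Y).filter (fun a => (rle a.w τ).val) = X := by
        intro X Y hX hY
        rw [List.filter_append, List.filter_eq_self.2, List.filter_eq_nil_iff.2, List.append_nil]
        · intro b hb
          simpa using hY b hb
        · intro a ha
          simpa using hX a ha
      have : A' = A := by
        rw [← hfilter A' B' hA'τ hB'τ, ← hL, hAB, hfilter A B hA hB]
      rw [this] at hlt
      exact absurd hρ (not_le.2 hlt)
    obtain ⟨y, B₂, rfl, hy⟩ := hB'ne
    have hyB : y ∉ B := fun h => absurd hy (not_le.2 (hB y h))
    obtain ⟨A₃, rfl⟩ : ∃ A₃, A = A' ++ y :: A₃ := by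
      rcases List.append_eq_append_iff.1 (hAB.symm.trans hL) with ⟨C, -, hC⟩ | ⟨C, hC, hC'⟩
      · exact absurd (by simp [hC]) hyB
      · cases C with
        | nil => exact absurd (by rw [← List.nil_append B, ← hC']; simp) hyB
        | cons z C =>
          obtain ⟨rfl, -⟩ : y = z ∧ B₂ = C ++ B := by simpa using hC'
          exact ⟨C, hC⟩
    have hcross := hB' y B₂ rfl
    rw [if_pos hy, rlt_val, not_lt] at hcross
    refine crossesAt_of_eq (Q := F.map Item.plain ++
      st.small.toList.map (Item.withWeight st.thr) ++ A'.map Item.plain)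
      (y := y.plain) (Q' := A₃.map Item.plain) ?_ ?_ hlt ?_
    · simp
    · simp [hcount, add_assoc]
    · refine hcross.trans (le_of_eq ?_)
      rw [gap_append, gap_append, hgap]
      simp [gap]
      ring

theorem findDrop_spec {st : State} {x : Item} {pre : Pre} {A B : List Item} {τ r : ℝ}
    (hs : st.small.Good) (hl : pre.large.Good)
    (hsort : (pre.large.toList.map Item.w).Pairwise (· ≤ ·))
    (hsmall : pre.isSmall = true ↔ x.w ≤ st.thr)
    (hcount : pre.count = (fresh st x).length + st.small.toList.length)
    (hsum : pre.sum = weight (fresh st x) + st.small.toList.length * st.thr)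
    (hAB : pre.large.toList = A ++ B) (hA : ∀ a ∈ A, a.w ≤ τ) (hB : ∀ b ∈ B, τ < b.w)
    (hτ : 0 < τ) (hr : r ∈ Set.Ioo (0 : ℝ) 1)
    (hgap : gap τ (smallSample st x ++ A.map Item.plain) = τ) :
    CrossesAt τ (r * τ) (smallSample st x ++ A.map Item.plain) (findDrop st x pre τ r).val := by
  have hρ : 0 < r * τ := mul_pos hr.1 hτ
  have hρτ : r * τ ≤ τ := by nlinarith [hr.2]
  simp only [findDrop, Timed.val_bind, Timed.val_ite, hsmall, rmul_val, rsub_val, rle_val,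
    Timed.val_step]
  split_ifs with h h'
  · have hf : fresh st x = [x] := by rw [fresh, if_pos h]
    refine crossesAt_of_eq (Q := []) (y := x.plain) (Q' := st.small.toList.map
      (Item.withWeight st.thr) ++ A.map Item.plain) ?_ rfl (by simpa using hρ) ?_
    · simp [smallSample, hf]
    · simpa [gap_cons] using h'
  · have hf : fresh st x = [x] := by rw [fresh, if_pos h]
    have := findDropOld_spec (F := fresh st x) (τ := τ) (ρ := r * τ) hs hl hsort hcount hsum hAB
      hA hB (by simpa [hf, gap_cons] using h') (hρτ.trans hgap.ge)
    simpa [hf, smallSample] using this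
  · have hf : fresh st x = [] := by rw [fresh, if_neg h]
    have := findDropOld_spec (F := fresh st x) (τ := τ) (ρ := r * τ) hs hl hsort hcount hsum hAB
      hA hB (by simpa [hf] using hρ) (hρτ.trans hgap.ge)
    simpa [hf, smallSample] using this

/-! ### Updating the trees -/

theorem insertSmall_spec {st : State} {x : Item} {pre : Pre} {D : ℕ} (hs : st.small.Good)
    (hD : st.small.depth ≤ D) (hsmall : pre.isSmall = true ↔ x.w ≤ st.thr) :
    (insertSmall st x pre).val.toList = smallItems st x ∧ (insertSmall st x pre).val.Good ∧
      (insertSmall st x pre).time ≤ 257 * D + 54 := by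
  obtain ⟨h₁, h₂, h₃⟩ := Tree.insertAt_good hs hD 0 x
  unfold insertSmall smallItems fresh
  simp only [hsmall]
  split_ifs with h
  · exact ⟨by simpa using h₁, h₂, h₃⟩
  · exact ⟨by simp, hs, by simp⟩

theorem dropItem_spec {sm : Tree} {pre : Pre} {A B : List Item} {D p t : ℕ} (hs : sm.Good)
    (hl : pre.large.Good) (hsD : sm.depth ≤ D) (hlD : pre.large.depth ≤ D)
    (hAB : pre.large.toList = A ++ B) (hcount : pre.count = sm.toList.length)
    (ht : t = pre.count + A.length) (hp : p < t) :
    (dropItem sm pre t p).val.1.Good ∧ (dropItem sm pre t p).val.2.1.Good ∧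
      (∃ A', (dropItem sm pre t p).val.1.toList ++ A' = (sm.toList ++ A).eraseIdx p ∧
        (dropItem sm pre t p).val.2.1.toList = A' ++ B ∧
        (dropItem sm pre t p).val.2.2 = A'.length ∧ (A = [] → A' = [])) ∧
      (dropItem sm pre t p).time ≤ 563 * D + 60 := by
  obtain ⟨h₁, h₂, h₃⟩ := Tree.deleteAt_good hs hsD p
  obtain ⟨h₄, h₅, h₆⟩ := Tree.deleteAt_good hl hlD (p - pre.count)
  simp only [dropItem, Timed.val_bind, Timed.val_ite, Timed.time_bind, Timed.time_ite, nlt_val,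
    nlt_time, nsub_val, nsub_time, Timed.val_pure, Timed.time_pure]
  split_ifs with h
  · refine ⟨h₂, hl, ⟨A, ?_, hAB, by simp [ht], id⟩, by omega⟩
    rw [h₁, List.eraseIdx_append_of_lt_length (by omega)]
  · refine ⟨hs, h₅, ⟨A.eraseIdx (p - pre.count), ?_, ?_, ?_, ?_⟩, by omega⟩
    · rw [List.eraseIdx_append_of_length_le (by omega), hcount]
    · rw [h₄, hAB, List.eraseIdx_append_of_lt_length (by omega)]
    · rw [List.length_eraseIdx_of_lt (by omega)]
      dsimp only
      omega
    · rintro rfl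
      simp

/-- The height bound for trees with at most `k + 1` items. -/
theorem Tree.Good.depth_le {t : Tree} {k : ℕ} (ht : t.Good) (h : t.toList.length ≤ k + 1) :
    t.depth ≤ Nat.log 2 ((k + 2) ^ 2) :=
  Nat.le_log_of_pow_le one_lt_two ((Tree.two_pow_depth_le ht.balanced).trans
    (Nat.pow_le_pow_left (by omega) 2))

/-- What has to be known about a full reservoir to process the next item. -/
structure Ready (k : ℕ) (st : State) : Prop where
  large_good : st.large.Good
  small_good : st.small.Good
  sorted : (st.large.toList.map Item.w).Pairwise (· ≤ ·)
  thr_nonneg : 0 ≤ st.thr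
  thr_pos : st.small.toList ≠ [] → 0 < st.thr
  small_ne_nil : 0 < st.thr → st.small.toList ≠ []
  small_le : ∀ y ∈ st.small.toList, y.w ≤ st.thr
  thr_lt : ∀ y ∈ st.large.toList, st.thr < y.w
  card : st.small.toList.length + st.large.toList.length = k

/-- Processing an item when the reservoir is full: `A ++ B` are the large items including the new
item, and those in `A` become small. -/
theorem processFull_spec {k : ℕ} {st : State} (h : Ready k st) (hk : 1 ≤ k) {x : Item}
    (hx : 0 < x.w) :
    ∃ (A B : List Item) (τ : ℝ), (fresh st x ++ (A ++ B)).Perm (x :: st.large.toList) ∧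
      ((A ++ B).map Item.w).Pairwise (· ≤ ·) ∧ (∀ a ∈ A ++ B, st.thr < a.w) ∧ 0 < τ ∧
      (∀ u ∈ smallSample st x ++ A.map Item.plain, u.2 ≤ τ) ∧ (∀ b ∈ B, τ < b.w) ∧
      gap τ (smallSample st x ++ A.map Item.plain) = τ ∧
      2 ≤ (smallSample st x ++ A.map Item.plain).length ∧
      ∀ r ∈ Set.Ioo (0 : ℝ) 1, ∃ p,
        CrossesAt τ (r * τ) (smallSample st x ++ A.map Item.plain) p ∧
        (processFull st x r).val.thr = τ ∧ (processFull st x r).val.large.Good ∧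
        (processFull st x r).val.small.Good ∧ (processFull st x r).val.large.toList = B ∧
        (processFull st x r).val.small.toList = (smallItems st x ++ A).eraseIdx p ∧
        (processFull st x r).time ≤ 1600 * Nat.log 2 ((k + 2) ^ 2) + 300 := by
  have hcard := h.card
  set D := Nat.log 2 ((k + 2) ^ 2) with hDdef
  have hlD : st.large.depth ≤ D := h.large_good.depth_le (by omega)
  have hsD : st.small.depth ≤ D := h.small_good.depth_le (by omega)
  obtain ⟨g, hsort, hperm, hsmall, hcount, hsum, hT⟩ :=
    prepare_spec h.large_good h.small_good hlD h.sorted x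
  generalize hpre : (prepare st x).val = pre at *
  have hlen := hperm.length_eq
  simp only [List.length_append, List.length_cons] at hlen
  have hpD : pre.large.depth ≤ D := g.depth_le (by omega)
  have hlt : ∀ y ∈ pre.large.toList, st.thr < y.w := by
    intro y hy
    rcases List.mem_cons.1 (hperm.subset (List.mem_append_right _ hy)) with rfl | hy'
    · by_contra hle
      have hf : fresh st y = [y] := by rw [fresh, if_pos (not_lt.1 hle)]
      rw [hf, List.singleton_append, List.perm_cons] at hperm
      exact hle (h.thr_lt y (hperm.subset hy))
    · exact h.thr_lt y hy'
  obtain ⟨hTc, A, B, hAB, hcut, τ, hτ, hτ0, hU, hB, hgap, h2⟩ := findCut_spec (U₀ := smallSample st x)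
    (θ := st.thr) g hpD hsort (by simpa using hcount) (by simpa using hsum) (by
      intro u hu
      refine ⟨?_, smallSample_le hu⟩
      rcases List.mem_append.1 hu with hu | hu
      · obtain ⟨y, hy, rfl⟩ := List.mem_map.1 hu
        rw [(eq_of_mem_fresh hy).1]
        exact hx
      · obtain ⟨y, hy, rfl⟩ := List.mem_map.1 hu
        exact h.thr_pos (List.ne_nil_of_mem hy)) h.thr_nonneg (by
      rw [length_smallSample, adjSum_smallSample]
      have hle : (((fresh st x).length + st.small.toList.length - 1 : ℕ) : ℝ) ≤
          st.small.toList.length := by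
        have := fresh_length_le st x
        exact_mod_cast (by omega : (fresh st x).length + st.small.toList.length - 1 ≤ _)
      have hw : 0 ≤ weight (fresh st x) := by
        unfold fresh
        split_ifs
        · simpa using hx.le
        · simp
      have := mul_le_mul_of_nonneg_right hle h.thr_nonneg
      linarith) hlt (by rw [length_smallSample]; omega)
  refine ⟨A, B, τ, hAB ▸ hperm, hAB ▸ hsort, hAB ▸ hlt, hτ0, hU, hB, hgap, h2, ?_⟩
  intro r hr
  have hcross := findDrop_spec h.small_good g hsort hsmall hcount hsum hAB
    (fun a ha => hU a.plain (by simp [List.mem_map_of_mem ha])) hB hτ0 hr hgap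
  have hTd := findDrop_time_le st x pre τ r hsD hpD
  obtain ⟨hsm, hsmg, hTs⟩ := insertSmall_spec h.small_good hsD hsmall
  have hsml : (insertSmall st x pre).val.toList.length = pre.count := by
    rw [hsm, hcount]; simp [smallItems]
  have hp : (findDrop st x pre τ r).val < (findCut pre).val.1 := by
    have := hcross.1
    rw [List.length_append, length_smallSample, List.length_map] at this
    omega
  obtain ⟨gs, gl, ⟨A', hA', hlg, hA'len, hA'nil⟩, hTD⟩ := dropItem_spec hsmg g
    (hsmg.depth_le (by have := fresh_length_le st x; omega)) hpD hAB hsml.symm hcut hp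
  refine ⟨(findDrop st x pre τ r).val, hcross, ?_⟩
  simp only [processFull, Timed.val_bind, Timed.val_ite, Timed.time_bind, Timed.time_ite, nlt_val,
    nlt_time, nsub_val, nsub_time, toReal_val, toReal_time, rdiv_val, rdiv_time, Timed.val_pure,
    Timed.time_pure, hpre, ← hτ]
  rw [hsm] at hA'
  generalize (dropItem (insertSmall st x pre).val pre (findCut pre).val.1
    (findDrop st x pre τ r).val) = res at *
  have hlenA := congrArg List.length hA'
  rw [List.length_eraseIdx_of_lt (by rw [← hsm]; simp; omega)] at hlenA
  have hlenl := congrArg List.length hlg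
  have hlenAB := congrArg List.length hAB
  have hlens := congrArg List.length hsm
  simp only [List.length_append] at hlenA hlenl hlenAB
  have hresl : res.val.2.1.depth ≤ D := gl.depth_le (by omega)
  have hress : res.val.1.depth ≤ D := gs.depth_le (by omega)
  obtain ⟨g₁, g₂, d₁, d₂, hTsp⟩ := Tree.split_good gl res.val.2.2
  obtain ⟨e₁, e₂⟩ := Tree.toList_split gl res.val.2.2
  rw [hlg, hA'len, List.take_left] at e₁
  rw [hlg, hA'len, List.drop_left] at e₂
  obtain ⟨e₃, g₃, hTcc⟩ := Tree.concat_good (D := D) gs g₁ hress (by omega)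
  rw [hA'len] at e₃ g₁ g₂ g₃ d₁ d₂ hTsp hTcc
  rw [hA'len]
  split_ifs with hm
  · refine ⟨rfl, g₂, g₃, e₂, ?_, by omega⟩
    rw [e₃, e₁, hA']
  · obtain rfl : A = [] := List.length_eq_zero_iff.1 (by omega)
    obtain rfl := hA'nil rfl
    refine ⟨rfl, gl, gs, by simpa using hlg, by simpa using hA', by omega⟩

/-! ### One round of sampling -/

theorem sum_map_one_sub_div {τ : ℝ} (hτ : 0 < τ) (l : List (ℕ × ℝ)) :
    (l.map fun p => 1 - p.2 / τ).sum = gap τ l / τ := by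
  induction l with
  | nil => simp
  | cons p l ih =>
    rw [List.map_cons, List.sum_cons, ih, gap_cons]
    field_simp

theorem sum_map_min_of_le {σ : ℝ} (hσ : 0 < σ) {l : List (ℕ × ℝ)} (h : ∀ p ∈ l, p.2 ≤ σ) :
    (l.map fun p => min 1 (p.2 / σ)).sum = adjSum l / σ := by
  induction l with
  | nil => simp
  | cons p l ih =>
    rw [List.map_cons, List.sum_cons, ih fun q hq => h q (by simp [hq]), adjSum_cons,
      min_eq_right ((div_le_one hσ).2 (h p (by simp)))]
    ring

theorem sum_map_min_of_lt {σ : ℝ} (hσ : 0 < σ) {l : List (ℕ × ℝ)} (h : ∀ p ∈ l, σ < p.2) :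
    (l.map fun p => min 1 (p.2 / σ)).sum = l.length := by
  induction l with
  | nil => simp
  | cons p l ih =>
    rw [List.map_cons, List.sum_cons, ih fun q hq => h q (by simp [hq]),
      min_eq_left ((one_le_div hσ).2 (h p (by simp)).le)]
    simp [add_comm]

/-- A cut of the items into those of adjusted weight at most, and those above the threshold. -/
structure Cut (k : ℕ) (τ : ℝ) (U V : List (ℕ × ℝ)) : Prop where
  pos : 0 < τ
  sorted : (U ++ V).Pairwise (fun p q => p.2 ≤ q.2)
  le : ∀ u ∈ U, u.2 ≤ τ
  lt : ∀ v ∈ V, τ < v.2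
  gap_eq : gap τ U = τ
  two_le : 2 ≤ U.length
  card : U.length + V.length = k + 1

namespace Cut

variable {k p : ℕ} {τ r : ℝ} {U V pre : List (ℕ × ℝ)}

theorem sum_min_eq (h : Cut k τ U V) :
    ((U ++ V).map fun p => min 1 (p.2 / τ)).sum = k := by
  rw [List.map_append, List.sum_append, sum_map_min_of_le h.pos h.le, sum_map_min_of_lt h.pos h.lt]
  have h₁ := h.gap_eq
  have h₂ : (U.length : ℝ) + V.length = k + 1 := by exact_mod_cast h.card
  have h₃ := h.pos
  rw [gap] at h₁
  rw [show adjSum U = (U.length - 1) * τ by linarith]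
  field_simp
  linarith

/-- The items left after dropping the one at position `p`. -/
def rest (τ : ℝ) (U V : List (ℕ × ℝ)) (p : ℕ) : List (ℕ × ℝ) :=
  (U.eraseIdx p).map (fun q => (q.1, τ)) ++ V

theorem sum_min_rest (h : Cut k τ U V) (hp : p < U.length) {σ : ℝ} (hσ : τ ≤ σ) :
    ((rest τ U V p).map fun p => min 1 (p.2 / σ)).sum =
      ((U ++ V).map fun p => min 1 (p.2 / σ)).sum := by
  have hσ0 := h.pos.trans_le hσ
  rw [rest, List.map_append, List.map_append, List.sum_append, List.sum_append,
    sum_map_min_of_le hσ0 (l := U) fun u hu => (h.le u hu).trans hσ, List.map_map]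
  have h₁ := h.gap_eq
  rw [gap] at h₁
  rw [show adjSum U = (U.length - 1) * τ by linarith]
  simp only [Function.comp_def, List.map_const', List.sum_replicate, nsmul_eq_mul,
    List.length_eraseIdx_of_lt hp, min_eq_right ((div_le_one hσ0).2 hσ)]
  rw [Nat.cast_sub (by omega)]
  simp only [Nat.cast_one]
  ring

theorem gap_take_lt (h : Cut k τ U V) {ρ : ℝ} (hc : CrossesAt τ ρ U p) {e : ℕ} (he : e < p) :
    gap τ (U.take (e + 1)) < ρ :=
  (gap_take_mono he fun u hu => h.le u (List.mem_of_mem_take hu)).trans_lt hc.2.1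

theorem crossesAt_unique (h : Cut k τ U V) {ρ : ℝ} {q : ℕ} (hp : CrossesAt τ ρ U p)
    (hq : CrossesAt τ ρ U q) : p = q := by
  rcases lt_trichotomy p q with hlt | rfl | hlt
  · exact absurd hp.2.2 (not_le.2 (h.gap_take_lt hq hlt))
  · rfl
  · exact absurd hq.2.2 (not_le.2 (h.gap_take_lt hp hlt))

theorem isRound (h : Cut k τ U V) (hperm : (U ++ V).Perm pre)
    (hc : CrossesAt τ (r * τ) U p) : IsRound k pre r τ (rest τ U V p) := by
  have htake : ∀ e ≤ p, ((U ++ V).take (e + 1)) = U.take (e + 1) := fun e he =>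
    List.take_append_of_le_length (by have := hc.1; omega)
  refine ⟨h.pos, ?_, U ++ V, hperm, h.sorted, p, by simp; have := hc.1; omega, ?_, ?_, ?_, ?_⟩
  · rw [← h.sum_min_eq]
    exact (hperm.symm.map _).sum_eq
  · rw [List.getElem_append_left hc.1]
    exact h.le _ (List.getElem_mem _)
  · rw [htake p le_rfl, sum_map_one_sub_div h.pos, le_div_iff₀ h.pos]
    exact hc.2.2
  · intro e he
    rw [htake e he.le, sum_map_one_sub_div h.pos, div_lt_iff₀ h.pos]
    exact h.gap_take_lt hc he
  · rw [List.eraseIdx_append_of_lt_length hc.1, List.map_append, rest]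
    refine List.Perm.of_eq (congrArg₂ _ (List.map_congr_left fun q hq => ?_) ?_)
    · rw [max_eq_right (h.le q (List.mem_of_mem_eraseIdx hq))]
    · symm
      rw [List.map_congr_left (g := id) fun q hq => ?_, List.map_id]
      rw [max_eq_left (h.lt q hq).le]
      rfl

theorem map_fst_rest : (rest τ U V p).map Prod.fst =
    (U.map Prod.fst).eraseIdx p ++ V.map Prod.fst := by
  simp [rest, List.eraseIdx_map, Function.comp_def]

theorem fst_notMem_rest_iff (hnd : ((U ++ V).map Prod.fst).Nodup) (hp : p < U.length) {i : ℕ}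
    (hi : i < U.length) : U[i].1 ∉ (rest τ U V p).map Prod.fst ↔ i = p := by
  rw [map_fst_rest]
  rw [List.map_append, List.nodup_append] at hnd
  have hm : U[i].1 ∈ U.map Prod.fst := List.mem_map_of_mem (List.getElem_mem hi)
  have hV : U[i].1 ∉ V.map Prod.fst := fun h => hnd.2.2 _ hm _ h rfl
  rw [List.mem_append, or_iff_left hV, List.mem_eraseIdx_iff_getElem]
  constructor
  · intro h
    by_contra hne
    exact h ⟨i, by simpa using hi, hne, by simp⟩
  · rintro rfl ⟨a, ha, hne, he⟩
    apply hne
    rw [← hnd.1.getElem_inj_iff (hi := ha) (hj := by simpa using hi), he]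
    simp

/-- The probability of dropping an item. -/
theorem volume_dropped (h : Cut k τ U V) (hnd : ((U ++ V).map Prod.fst).Nodup)
    {f : ℝ → List (ℕ × ℝ)}
    (hf : ∀ r ∈ Set.Ioo (0 : ℝ) 1, ∃ p, CrossesAt τ (r * τ) U p ∧ f r = rest τ U V p)
    {q : ℕ × ℝ} (hq : q ∈ U ++ V) :
    volume {ρ : ℝ | ρ ∈ Set.Ioo (0 : ℝ) 1 ∧ q.1 ∉ (f ρ).map Prod.fst} =
      ENNReal.ofReal (1 - min 1 (q.2 / τ)) := by
  have hτ := h.pos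
  rcases List.mem_append.1 hq with hq | hq
  · obtain ⟨i, hi, rfl⟩ := List.getElem_of_mem hq
    set a := gap τ (U.take i) / τ with ha
    set b := gap τ (U.take (i + 1)) / τ with hb
    have hset : {ρ : ℝ | ρ ∈ Set.Ioo (0 : ℝ) 1 ∧ U[i].1 ∉ (f ρ).map Prod.fst} =
        Set.Ioo 0 1 ∩ Set.Ioc a b := by
      ext ρ
      simp only [Set.mem_ofPred_eq, Set.mem_inter_iff, and_congr_right_iff]
      intro hρ
      obtain ⟨p, hp, hfp⟩ := hf ρ hρ
      rw [hfp, fst_notMem_rest_iff hnd hp.1 hi, Set.mem_Ioc, ha, hb, div_lt_iff₀ hτ,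
        le_div_iff₀ hτ]
      constructor
      · rintro rfl
        exact hp.2
      · intro hc
        exact h.crossesAt_unique ⟨hi, hc⟩ hp
    have ha0 : 0 ≤ a := div_nonneg (gap_nonneg fun u hu => h.le u (List.mem_of_mem_take hu)) hτ.le
    have hb1 : b ≤ 1 := by
      rw [hb, div_le_one hτ]
      refine le_of_le_of_eq ?_ h.gap_eq
      have := gap_take_mono (τ := τ) (l := U) (m := i + 1) (n := U.length) hi
        fun u hu => h.le u (List.mem_of_mem_take hu)
      rwa [List.take_length] at this
    have hab : b - a = 1 - min 1 (U[i].2 / τ) := by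
      rw [min_eq_right ((div_le_one hτ).2 (h.le _ hq)), ha, hb, List.take_succ_eq_append_getElem hi,
        gap_append, gap_cons, gap_nil]
      field_simp
      ring
    rw [hset, ← hab]
    apply le_antisymm
    · rw [← Real.volume_Ioc]
      exact measure_mono Set.inter_subset_right
    · rw [← Real.volume_Ioo]
      exact measure_mono fun ρ hρ =>
        ⟨⟨ha0.trans_lt hρ.1, hρ.2.trans_le hb1⟩, hρ.1, hρ.2.le⟩
  · rw [min_eq_left ((one_le_div hτ).2 (h.lt q hq).le), sub_self, ENNReal.ofReal_zero]
    convert measure_empty (μ := (volume : Measure ℝ))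
    rw [Set.eq_empty_iff_forall_notMem]
    rintro ρ ⟨hρ, hn⟩
    obtain ⟨p, -, hfp⟩ := hf ρ hρ
    apply hn
    rw [hfp, map_fst_rest]
    exact List.mem_append_right _ (List.mem_map_of_mem hq)

end Cut

/-- The cut made when the reservoir is full, and the resulting state. -/
theorem processFull_cut {k : ℕ} {st : State} (h : Ready k st) (hk : 1 ≤ k) {x : Item}
    (hx : 0 < x.w) :
    ∃ (U V : List (ℕ × ℝ)) (τ : ℝ), Cut k τ U V ∧ (U ++ V).Perm (x.plain :: st.sample) ∧
      st.thr ≤ τ ∧ ∀ r ∈ Set.Ioo (0 : ℝ) 1, ∃ p, CrossesAt τ (r * τ) U p ∧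
        (processFull st x r).val.thr = τ ∧ (processFull st x r).val.large.Good ∧
        (processFull st x r).val.small.Good ∧
        (processFull st x r).val.sample = Cut.rest τ U V p ∧
        (processFull st x r).val.small.toList ≠ [] ∧
        ((processFull st x r).val.large.toList.map Item.w).Pairwise (· ≤ ·) ∧
        (∀ y ∈ (processFull st x r).val.large.toList,
          y ∈ x :: (st.small.toList ++ st.large.toList) ∧ τ < y.w) ∧
        (∀ y ∈ (processFull st x r).val.small.toList,
          y ∈ x :: (st.small.toList ++ st.large.toList) ∧ y.w ≤ τ) ∧
        (processFull st x r).time ≤ 1600 * Nat.log 2 ((k + 2) ^ 2) + 300 := by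
  obtain ⟨A, B, τ, hperm, hsort, hAB, hτ, hU, hB, hgap, h2, hmain⟩ := processFull_spec h hk hx
  have hthr : st.thr ≤ τ := by
    rcases h.thr_nonneg.eq_or_lt with h0 | h0
    · exact h0 ▸ hτ.le
    · obtain ⟨y, hy⟩ := List.exists_mem_of_ne_nil _ (h.small_ne_nil h0)
      refine hU (y.withWeight st.thr) ?_
      simp only [smallSample, List.mem_append]
      exact Or.inl (Or.inr (List.mem_map_of_mem hy))
  have hpermUV : (smallSample st x ++ A.map Item.plain ++ B.map Item.plain).Perm
      (x.plain :: st.sample) := by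
    have h₁ := hperm.map Item.plain
    simp only [List.map_append, List.map_cons] at h₁
    rw [State.sample_eq, smallSample, List.append_assoc, List.append_assoc]
    refine (List.perm_append_comm_assoc _ _ _).trans ?_
    exact (h₁.append_left _).trans List.perm_middle
  have hmem : ∀ y ∈ A ++ B, y ∈ x :: (st.small.toList ++ st.large.toList) := by
    intro y hy
    have := hperm.subset (List.mem_append_right _ hy)
    simp only [List.mem_cons, List.mem_append] at this ⊢
    tauto
  refine ⟨smallSample st x ++ A.map Item.plain, B.map Item.plain, τ,
    ⟨hτ, ?_, hU, ?_, hgap, h2, ?_⟩, hpermUV, hthr, ?_⟩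
  · rw [List.append_assoc, ← List.map_append, List.pairwise_append]
    refine ⟨?_, List.pairwise_map.2 (List.pairwise_map.1 hsort), ?_⟩
    · rw [smallSample, List.pairwise_append]
      refine ⟨?_, ?_, ?_⟩
      · unfold fresh
        split_ifs <;> simp
      · rw [List.pairwise_map]
        exact List.pairwise_of_forall fun _ _ => le_rfl
      · intro p hp q hq
        obtain ⟨z, hz, rfl⟩ := List.mem_map.1 hq
        exact smallSample_le (st := st) (x := x) (List.mem_append_left _ hp)
    · intro p hp q hq
      obtain ⟨z, hz, rfl⟩ := List.mem_map.1 hq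
      exact (smallSample_le hp).trans (hAB z hz).le
  · intro v hv
    obtain ⟨y, hy, rfl⟩ := List.mem_map.1 hv
    exact hB y hy
  · rw [← List.length_append, hpermUV.length_eq, List.length_cons, State.sample_eq,
      List.length_append, List.length_map, List.length_map, h.card]
  intro r hr
  obtain ⟨p, hp, e₁, g₁, g₂, e₂, e₃, hT⟩ := hmain r hr
  refine ⟨p, hp, e₁, g₁, g₂, ?_, ?_, ?_, ?_, ?_, hT⟩
  · rw [State.sample_eq, e₁, e₂, e₃, Cut.rest]
    congr 1
    rw [← List.eraseIdx_map, ← List.eraseIdx_map]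
    congr 1
    simp only [smallItems, smallSample, List.map_append, List.map_map]
    rfl
  · rw [e₃]
    intro h0
    have := congrArg List.length h0
    have hpl := hp.1
    rw [List.length_append, length_smallSample, List.length_map] at hpl h2
    rw [List.length_eraseIdx_of_lt (by simp [smallItems]; omega)] at this
    simp [smallItems] at this
    omega
  · rw [e₂]
    rw [List.map_append, List.pairwise_append] at hsort
    exact hsort.2.1
  · rw [e₂]
    exact fun y hy => ⟨hmem y (List.mem_append_right _ hy), hB y hy⟩
  · rw [e₃]
    intro y hy
    rcases List.mem_append.1 (List.mem_of_mem_eraseIdx hy) with hy | hy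
    · rcases List.mem_append.1 hy with hy | hy
      · obtain ⟨rfl, hle⟩ := eq_of_mem_fresh hy
        exact ⟨by simp, hle.trans hthr⟩
      · exact ⟨by simp [hy], (h.small_le y hy).trans hthr⟩
    · refine ⟨hmem y (List.mem_append_left _ hy), hU y.plain ?_⟩
      exact List.mem_append_right _ (List.mem_map_of_mem hy)

/-! ### The invariant -/

/-- The state represents the reservoir, and the sample has the right total of truncated weights for
every threshold from the current one on. -/
structure Invariant (k : ℕ) (w : ℕ → ℝ) (j : ℕ) (st : State) : Prop where
  represents : Represents k w j st
  small_ne_nil : k < j → st.small.toList ≠ []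
  sum_min : ∀ σ, st.thr ≤ σ → 0 < σ →
    ∑ i ∈ Finset.range j, min 1 (w i / σ) = (st.sample.map fun p => min 1 (p.2 / σ)).sum

namespace Invariant

variable {k j : ℕ} {w : ℕ → ℝ} {st : State}

theorem large_good (h : Invariant k w j st) : st.large.Good :=
  ⟨h.represents.large_balanced, h.represents.large_augmented⟩

theorem small_good (h : Invariant k w j st) : st.small.Good :=
  ⟨h.represents.small_balanced, h.represents.small_augmented⟩

theorem card (h : Invariant k w j st) :
    st.small.toList.length + st.large.toList.length = min j k := by
  simpa [State.sample_eq] using h.represents.card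

theorem thr_nonneg (h : Invariant k w j st) : 0 ≤ st.thr := by
  rcases le_or_gt j k with hj | hj
  · exact (h.represents.thr_init hj).ge
  · exact (h.represents.thr_pos hj).le

theorem ready (h : Invariant k w j st) (hw : ∀ i, 0 < w i) (hj : k ≤ j) : Ready k st where
  large_good := h.large_good
  small_good := h.small_good
  sorted := h.represents.large_sorted
  thr_nonneg := h.thr_nonneg
  thr_pos hne := by
    obtain ⟨y, hy⟩ := List.exists_mem_of_ne_nil _ hne
    obtain ⟨-, h₁, h₂⟩ := h.represents.small_items y hy
    exact (h₁ ▸ hw y.id).trans_le h₂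
  small_ne_nil hpos := by
    rcases hj.eq_or_lt with rfl | hj
    · exact absurd (h.represents.thr_init le_rfl) hpos.ne'
    · exact h.small_ne_nil hj
  small_le y hy := (h.represents.small_items y hy).2.2
  thr_lt y hy := (h.represents.large_items y hy).2.2
  card := by rw [h.card, min_eq_right hj]

theorem mem_items (h : Invariant k w j st) {y : Item}
    (hy : y ∈ (⟨j, w j⟩ : Item) :: (st.small.toList ++ st.large.toList)) :
    y.id < j + 1 ∧ y.w = w y.id := by
  rcases List.mem_cons.1 hy with rfl | hy
  · exact ⟨Nat.lt_succ_self j, rfl⟩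
  · rcases List.mem_append.1 hy with hy | hy
    · obtain ⟨h₁, h₂, -⟩ := h.represents.small_items y hy
      exact ⟨h₁.trans (Nat.lt_succ_self j), h₂⟩
    · obtain ⟨h₁, h₂, -⟩ := h.represents.large_items y hy
      exact ⟨h₁.trans (Nat.lt_succ_self j), h₂⟩

theorem nodup_cons (h : Invariant k w j st) (a : ℝ) :
    (((j, a) :: st.sample).map Prod.fst).Nodup := by
  rw [List.map_cons, List.nodup_cons]
  refine ⟨?_, h.represents.nodup⟩
  rw [State.sample_eq]
  simp only [List.map_append, List.map_map, List.mem_append, List.mem_map, Function.comp_apply,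
    Item.withWeight_fst, Item.plain_fst]
  rintro (⟨y, hy, he⟩ | ⟨y, hy, he⟩)
  · exact absurd he (h.represents.small_items y hy).1.ne
  · exact absurd he (h.represents.large_items y hy).1.ne

theorem process_eq_full (h : Invariant k w j st) (hj : k ≤ j) (x : Item) (r : ℝ) :
    (process k st x r).val = (processFull st x r).val ∧
      (process k st x r).time = (processFull st x r).time + 4 := by
  have hc := h.card
  have hn : ¬ st.large.toList.length + st.small.toList.length < k := by omega
  simp only [process, Timed.val_bind, Timed.time_bind, nlt_val, nadd_val,
    h.large_good.size_val, h.small_good.size_val, if_neg hn, Tree.size_time, nadd_time, nlt_time]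
  exact ⟨trivial, by ring⟩

theorem process_fill (h : Invariant k w j st) (hw : ∀ i, 0 < w i) (hj : j < k) (r : ℝ) :
    Invariant k w (j + 1) (process k st ⟨j, w j⟩ r).val ∧
      (process k st ⟨j, w j⟩ r).val.sample.Perm ((j, w j) :: st.sample) ∧
      (process k st ⟨j, w j⟩ r).time ≤ 1600 * Nat.log 2 ((k + 2) ^ 2) + 304 := by
  have hc := h.card
  have hn : st.large.toList.length + st.small.toList.length < k := by omega
  have hthr := h.represents.thr_init hj.le
  obtain ⟨g, hperm, hsort, hT⟩ := insertSorted_spec h.large_good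
    (h.large_good.depth_le (k := k) (by omega)) h.represents.large_sorted ⟨j, w j⟩
  have hval : (process k st ⟨j, w j⟩ r).val =
      ⟨(insertSorted st.large ⟨j, w j⟩).val, st.small, st.thr⟩ := by
    simp [process, h.large_good.size_val, h.small_good.size_val, hn]
  have htime : (process k st ⟨j, w j⟩ r).time =
      (insertSorted st.large ⟨j, w j⟩).time + 4 := by
    simp [process, h.large_good.size_val, h.small_good.size_val, hn]
    ring
  rw [hval, htime]
  have hsample : (State.mk (insertSorted st.large ⟨j, w j⟩).val st.small st.thr).sample.Perm
      ((j, w j) :: st.sample) := by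
    simp only [State.sample_eq]
    exact ((hperm.map Item.plain).append_left _).trans List.perm_middle
  refine ⟨⟨⟨g.balanced, h.represents.small_balanced, g.augmented, h.represents.small_augmented,
    hsort, ?_, ?_, ?_, ?_, fun _ => hthr, fun _ => ?_, fun _ => ?_⟩, fun _ => ?_, ?_⟩,
    hsample, by omega⟩
  · intro y hy
    have hy' := hperm.subset hy
    refine ⟨(h.mem_items (by simp at hy' ⊢; tauto)).1, (h.mem_items (by simp at hy' ⊢; tauto)).2, ?_⟩
    rcases List.mem_cons.1 hy' with rfl | hy'
    · exact hthr ▸ hw j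
    · exact (h.represents.large_items y hy').2.2
  · intro y hy
    obtain ⟨h₁, h₂, h₃⟩ := h.represents.small_items y hy
    exact ⟨h₁.trans (Nat.lt_succ_self j), h₂, h₃⟩
  · exact ((hsample.map Prod.fst).nodup_iff).2 (h.nodup_cons _)
  · rw [hsample.length_eq, List.length_cons, h.represents.card]
    omega
  · omega
  · omega
  · omega
  · intro σ hσ hσ0
    rw [Finset.sum_range_succ, h.sum_min σ hσ hσ0, (hsample.map _).sum_eq, List.map_cons,
      List.sum_cons, add_comm]

theorem process_full (h : Invariant k w j st) (hk : 1 ≤ k) (hw : ∀ i, 0 < w i) (hj : k ≤ j) :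
    ∃ (U V : List (ℕ × ℝ)) (τ : ℝ), Cut k τ U V ∧ (U ++ V).Perm ((j, w j) :: st.sample) ∧
      ∀ r ∈ Set.Ioo (0 : ℝ) 1, Invariant k w (j + 1) (process k st ⟨j, w j⟩ r).val ∧
        (process k st ⟨j, w j⟩ r).val.thr = τ ∧
        (∃ p, CrossesAt τ (r * τ) U p ∧
          (process k st ⟨j, w j⟩ r).val.sample = Cut.rest τ U V p) ∧
        (process k st ⟨j, w j⟩ r).time ≤ 1600 * Nat.log 2 ((k + 2) ^ 2) + 304 := by
  obtain ⟨U, V, τ, hcut, hperm, hthr, hmain⟩ :=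
    processFull_cut (h.ready hw hj) hk (x := ⟨j, w j⟩) (hw j)
  refine ⟨U, V, τ, hcut, hperm, fun r hr => ?_⟩
  obtain ⟨e, ht⟩ := h.process_eq_full hj ⟨j, w j⟩ r
  obtain ⟨p, hp, e₁, g₁, g₂, e₂, hne, hsort, hl, hs, hT⟩ := hmain r hr
  rw [e, ht]
  have hsum : ∀ σ, τ ≤ σ → ∑ i ∈ Finset.range (j + 1), min 1 (w i / σ) =
      ((U ++ V).map fun p => min 1 (p.2 / σ)).sum := by
    intro σ hσ
    rw [Finset.sum_range_succ, h.sum_min σ (hthr.trans hσ) (hcut.pos.trans_le hσ),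
      (hperm.map _).sum_eq, List.map_cons, List.sum_cons, add_comm]
    rfl
  refine ⟨⟨⟨g₁.balanced, g₂.balanced, g₁.augmented, g₂.augmented, hsort, ?_, ?_, ?_, ?_,
    fun _ => ?_, fun _ => ?_, fun _ => ?_⟩, fun _ => hne, ?_⟩, e₁, ⟨p, hp, e₂⟩, by omega⟩
  · intro y hy
    exact ⟨(h.mem_items (hl y hy).1).1, (h.mem_items (hl y hy).1).2, e₁ ▸ (hl y hy).2⟩
  · intro y hy
    exact ⟨(h.mem_items (hs y hy).1).1, (h.mem_items (hs y hy).1).2, e₁ ▸ (hs y hy).2⟩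
  · have hnd := ((hperm.map Prod.fst).nodup_iff).2 (h.nodup_cons _)
    rw [List.map_append] at hnd
    rw [e₂, Cut.map_fst_rest]
    exact hnd.sublist ((List.eraseIdx_sublist _ _).append_right _)
  · rw [e₂, Cut.rest, List.length_append, List.length_map, List.length_eraseIdx_of_lt hp.1]
    have := hcut.card
    have := hp.1
    omega
  · omega
  · exact e₁ ▸ hcut.pos
  · rw [e₁, hsum τ le_rfl, hcut.sum_min_eq]
  · intro σ hσ _
    rw [e₁] at hσ
    rw [hsum σ hσ, e₂, hcut.sum_min_rest hp.1 hσ]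

theorem init (k : ℕ) (w : ℕ → ℝ) : Invariant k w 0 State.init where
  represents :=
    { large_balanced := trivial
      small_balanced := trivial
      large_augmented := trivial
      small_augmented := trivial
      large_sorted := by simp [State.init]
      large_items := by simp [State.init]
      small_items := by simp [State.init]
      nodup := by simp [State.sample_eq, State.init]
      card := by simp [State.sample_eq, State.init]
      thr_init := fun _ => rfl
      thr_pos := fun h => absurd h (Nat.not_lt_zero k)
      thr_eq := fun h => absurd h (Nat.not_lt_zero k) }
  small_ne_nil h := absurd h (Nat.not_lt_zero k)
  sum_min := by simp [State.sample_eq, State.init]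

end Invariant

theorem run_invariant {k : ℕ} (hk : 1 ≤ k) {w r : ℕ → ℝ} (hw : ∀ i, 0 < w i)
    (hr : ∀ i, r i ∈ Set.Ioo (0 : ℝ) 1) (j : ℕ) : Invariant k w j (run k w r j) := by
  induction j with
  | zero => exact Invariant.init k w
  | succ j ih =>
    rcases lt_or_ge j k with hj | hj
    · exact (ih.process_fill hw hj (r j)).1
    · obtain ⟨U, V, τ, -, -, h⟩ := ih.process_full hk hw hj
      exact (h (r j) (hr j)).1

theorem natLog_bound {k : ℕ} (hk : 1 ≤ k) :
    ((1600 * Nat.log 2 ((k + 2) ^ 2) + 304 : ℕ) : ℝ) ≤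
      6704 / Real.log 2 * Real.log ((k : ℝ) + 1) := by
  have hlog2 : 0 < Real.log 2 := Real.log_pos one_lt_two
  have hk1 : (1 : ℝ) ≤ k := by exact_mod_cast hk
  have h₁ : Real.log 2 ≤ Real.log ((k : ℝ) + 1) := Real.log_le_log two_pos (by linarith)
  have h₂ : (Nat.log 2 ((k + 2) ^ 2) : ℝ) * Real.log 2 ≤ 4 * Real.log ((k : ℝ) + 1) := by
    have hpow : (2 : ℝ) ^ Nat.log 2 ((k + 2) ^ 2) ≤ ((k : ℝ) + 1) ^ 4 := by
      have h : 2 ^ Nat.log 2 ((k + 2) ^ 2) ≤ (k + 2) ^ 2 := Nat.pow_log_le_self 2 (by positivity)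
      have h' : (2 : ℝ) ^ Nat.log 2 ((k + 2) ^ 2) ≤ ((k : ℝ) + 2) ^ 2 := by exact_mod_cast h
      refine h'.trans ?_
      rw [show ((k : ℝ) + 1) ^ 4 = (((k : ℝ) + 1) ^ 2) ^ 2 by ring]
      exact pow_le_pow_left₀ (by positivity) (by nlinarith) 2
    have := Real.log_le_log (by positivity) hpow
    rwa [Real.log_pow, Real.log_pow] at this
  push_cast
  rw [div_mul_eq_mul_div, le_div_iff₀ hlog2]
  linarith

end VarOpt

end

theorem mainTheorem4 :
    ∃ C : ℝ, ∀ (k : ℕ), 1 ≤ k → ∀ (w r : ℕ → ℝ), (∀ i, 0 < w i) →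
      (∀ i, r i ∈ Set.Ioo (0 : ℝ) 1) → ∀ j : ℕ,
        -- worst-case time for processing item `j`
        ((VarOpt.process k (VarOpt.run k w r j) ⟨j, w j⟩ (r j)).time : ℝ)
          ≤ C * Real.log ((k : ℝ) + 1) ∧
        -- the trees represent the reservoir, with the threshold of the stream seen so far
        VarOpt.Represents k w j (VarOpt.run k w r j) ∧
        -- the first `k` items fill the reservoir
        (j < k → (VarOpt.run k w r (j + 1)).sample.Perm
          ((j, w j) :: (VarOpt.run k w r j).sample)) ∧
        -- any later item leads to the right threshold and the right item being dropped
        (k ≤ j →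
          VarOpt.IsRound k ((j, w j) :: (VarOpt.run k w r j).sample) (r j)
            (VarOpt.run k w r (j + 1)).thr (VarOpt.run k w r (j + 1)).sample ∧
          ∀ p ∈ (j, w j) :: (VarOpt.run k w r j).sample,
            volume {ρ : ℝ | ρ ∈ Set.Ioo (0 : ℝ) 1 ∧
                p.1 ∉ (VarOpt.process k (VarOpt.run k w r j) ⟨j, w j⟩ ρ).val.sample.map Prod.fst}
              = ENNReal.ofReal (1 - min 1 (p.2 / (VarOpt.run k w r (j + 1)).thr))) := by
  refine ⟨6704 / Real.log 2, fun k hk w r hw hr j => ?_⟩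
  have h := VarOpt.run_invariant hk hw hr j
  have hbound := VarOpt.natLog_bound hk
  rcases lt_or_ge j k with hj | hj
  · obtain ⟨-, hperm, hT⟩ := h.process_fill hw hj (r j)
    exact ⟨(Nat.cast_le.2 hT).trans hbound, h.represents, fun _ => hperm,
      fun hj' => absurd hj (not_lt.2 hj')⟩
  · obtain ⟨U, V, τ, hcut, hperm, hmain⟩ := h.process_full hk hw hj
    obtain ⟨-, hthr, ⟨p, hp, hsample⟩, hT⟩ := hmain (r j) (hr j)
    refine ⟨(Nat.cast_le.2 hT).trans hbound, h.represents, fun hj' => absurd hj' (not_lt.2 hj),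
      fun _ => ?_⟩
    rw [VarOpt.run, hthr, hsample]
    refine ⟨hcut.isRound hperm hp, fun q hq => ?_⟩
    exact hcut.volume_dropped (((hperm.map Prod.fst).nodup_iff).2 (h.nodup_cons _))
      (f := fun ρ => (VarOpt.process k (VarOpt.run k w r j) ⟨j, w j⟩ ρ).val.sample)
      (fun ρ hρ => (hmain ρ hρ).2.2.1) (hperm.symm.subset hq)
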